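/- For $n\ge 2$ call an $n\times n$ matrix with entries in $\{0,1\}$ nondegenerate if none of its rows and columns is zero, and let $\mathbf M$ be the set of all nondegenerate matrices of all sizes $n\ge 2$. For $A\in\mathbf M$ of size $n$, let $\mathcal O_A$ be the Cuntz-Krieger algebra of $A$, i.e. the universal unital C$^*$-algebra generated by partial isometries $s^{(A)}_1,\dots,s^{(A)}_n$ with $s_i^*s_i=\sum_{j}A_{ij}s_js_j^*$ for all $i$ and $\sum_i s_is_i^*=1$. For $A,B\in\mathbf M$ of sizes $n,m$, let $A\boxtimes B$ be the Kronecker product, $(A\boxtimes B)_{m(i-1)+j,\,m(i'-1)+j'}=A_{ii'}B_{jj'}$, and let $\varphi_{A,B}:\mathcal O_{A\boxtimes B}\to\mathcal O_A\otimes\mathcal O_B$ (minimal C$^*$-tensor product) be the unital $*$-homomorphism with $\varphi_{A,B}(s^{(A\boxtimes B)}_{m(i-1)+j})=s^{(A)}_i\otimes s^{(B)}_j$. For unital $*$-representations $\pi_1$ of $\mathcal O_A$ and $\pi_2$ of $\mathcal O_B$ on Hilbert spaces put $\pi_1\otimes_\varphi\pi_2=(\pi_1\otimes\pi_2)\circ\varphi_{A,B}$,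 a representation of $\mathcal O_{A\boxtimes B}$; for states $\rho_1$ of $\mathcal O_A$ and $\rho_2$ of $\mathcal O_B$ put $\rho_1\otimes_\varphi\rho_2=(\rho_1\otimes\rho_2)\circ\varphi_{A,B}$, a state of $\mathcal O_{A\boxtimes B}$. A representation $\pi$ of a C$^*$-algebra $\mathcal A$ is a factor representation if the von Neumann algebra $\pi(\mathcal A)''$ is a factor. Two representations $\pi,\pi'$ of $\mathcal A$ are quasi-equivalent, $\pi\approx\pi'$, if there is a $*$-isomorphism $f:\pi(\mathcal A)''\to\pi'(\mathcal A)''$ with $f(\pi(x))=\pi'(x)$ for all $x\in\mathcal A$. Let $\pi_\rho$ denote the GNS representation of a state $\rho$. Then: (i) There exist $A\in\mathbf M$ and factor representations $\pi_1,\pi_2$ of $\mathcal O_A$ such that $\pi_1\otimes_\varphi\pi_2$ is not a factor representation of $\mathcal O_{A\boxtimes A}$. (ii) There exist $A\in\mathbf M$ and representations $\pi_1,\pi_2$ of $\mathcal O_A$ such that $\pi_1\otimes_\varphi\pi_2\not\approx\pi_2\otimes_\varphi\pi_1$. (iii) For all $A,B\in\mathbf M$, all representations $\pi_1,\pi_1'$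 of $\mathcal O_A$ and all representations $\pi_2,\pi_2'$ of $\mathcal O_B$: if $\pi_1\approx\pi_1'$ and $\pi_2\approx\pi_2'$, then $\pi_1\otimes_\varphi\pi_2\approx\pi_1'\otimes_\varphi\pi_2'$. (iv) There exist $A,B\in\mathbf M$ and states $\rho_1$ of $\mathcal O_A$ and $\rho_2$ of $\mathcal O_B$ such that $\pi_{\rho_1}\otimes_\varphi\pi_{\rho_2}\not\approx\pi_{\rho_1\otimes_\varphi\rho_2}$. -/

import Mathlib

open scoped TensorProduct ComplexOrder

universe u v w

noncomputable section

/-- A C⋆-seminorm on a unital complex ⋆-algebra. -/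
structure CStarSeminorm (F : Type v) [Ring F] [StarRing F] [Algebra ℂ F] [StarModule ℂ F]
    extends Seminorm ℂ F where
  mul_le' : ∀ x y : F, toFun (x * y) ≤ toFun x * toFun y
  star_mul_self' : ∀ x : F, toFun (star x * x) = toFun x * toFun x

namespace CStarSeminorm

variable {F : Type v} [Ring F] [StarRing F] [Algebra ℂ F] [StarModule ℂ F]

instance : CoeFun (CStarSeminorm F) (fun _ => F → ℝ) := ⟨fun N => N.toSeminorm⟩

theorem mul_le (N : CStarSeminorm F) (x y : F) : N (x * y) ≤ N x * N y := N.mul_le' x y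

theorem star_mul_self (N : CStarSeminorm F) (x : F) : N (star x * x) = N x * N x :=
  N.star_mul_self' x

theorem nonneg (N : CStarSeminorm F) (x : F) : 0 ≤ N x := apply_nonneg N.toSeminorm x

theorem map_star (N : CStarSeminorm F) (x : F) : N (star x) = N x := by
  have key : ∀ y : F, N y ≤ N (star y) := by
    intro y
    rcases (N.nonneg y).eq_or_lt with h | h
    · rw [← h]; exact N.nonneg _
    · have h1 := N.mul_le (star y) y
      rw [N.star_mul_self] at h1
      exact le_of_mul_le_mul_right h1 h
  refine le_antisymm ?_ (key x)
  simpa using key (star x)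

/-- The C⋆-seminorm obtained by pulling back the norm of a C⋆-algebra along a ⋆-homomorphism. -/
def ofHom {C : Type w} [CStarAlgebra C] (f : F →⋆ₐ[ℂ] C) : CStarSeminorm F where
  toFun x := ‖f x‖
  map_zero' := by simp
  add_le' x y := by rw [map_add]; exact norm_add_le _ _
  neg' x := by simp
  smul' c x := by simp [norm_smul]
  mul_le' x y := by rw [map_mul]; exact norm_mul_le _ _
  star_mul_self' x := by rw [map_mul, StarHomClass.map_star, CStarRing.norm_star_mul_self]

theorem ofHom_apply {C : Type w} [CStarAlgebra C] (f : F →⋆ₐ[ℂ] C) (x : F) :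
    ofHom f x = ‖f x‖ := rfl

/-- The pointwise supremum of a pointwise bounded family of C⋆-seminorms. -/
def iSup {ι : Sort w} (p : ι → CStarSeminorm F)
    (h : ∀ x, BddAbove (Set.range fun i => p i x)) : CStarSeminorm F where
  toFun x := ⨆ i, p i x
  map_zero' := by simp
  add_le' x y := by
    refine Real.iSup_le (fun i => ?_) (add_nonneg (Real.iSup_nonneg fun i => (p i).nonneg x)
      (Real.iSup_nonneg fun i => (p i).nonneg y))
    exact (map_add_le_add (p i).toSeminorm x y).trans
      (add_le_add (le_ciSup (h x) i) (le_ciSup (h y) i))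
  neg' x := by simp
  smul' c x := by simp [map_smul_eq_mul, Real.mul_iSup_of_nonneg]
  mul_le' x y := by
    have hx := Real.iSup_nonneg fun i => (p i).nonneg x
    refine Real.iSup_le (fun i => ?_) (mul_nonneg hx (Real.iSup_nonneg fun i => (p i).nonneg y))
    exact ((p i).mul_le x y).trans
      (mul_le_mul (le_ciSup (h x) i) (le_ciSup (h y) i) ((p i).nonneg y) hx)
  star_mul_self' x := by
    have hx := Real.iSup_nonneg fun i => (p i).nonneg x
    have hxx := Real.iSup_nonneg fun i => (p i).nonneg (star x * x)
    refine le_antisymm (Real.iSup_le (fun i => ?_) (mul_nonneg hx hx)) ?_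
    · rw [(p i).star_mul_self]
      exact mul_le_mul (le_ciSup (h x) i) (le_ciSup (h x) i) ((p i).nonneg x) hx
    · rw [← sq, ← Real.le_sqrt hx hxx]
      refine Real.iSup_le (fun i => ?_) (Real.sqrt_nonneg _)
      rw [Real.le_sqrt ((p i).nonneg x) hxx, sq, ← (p i).star_mul_self]
      exact le_ciSup (h (star x * x)) i

theorem le_iSup {ι : Sort w} (p : ι → CStarSeminorm F)
    (h : ∀ x, BddAbove (Set.range fun i => p i x)) (i : ι) (x : F) : p i x ≤ iSup p h x :=
  le_ciSup (h x) i

/-- The ⋆-algebra `F`, seminormed by `N`. -/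
def Pre (_N : CStarSeminorm F) : Type v := F

variable (N : CStarSeminorm F)

instance : Ring N.Pre := inferInstanceAs (Ring F)
instance : StarRing N.Pre := inferInstanceAs (StarRing F)
instance : Algebra ℂ N.Pre := inferInstanceAs (Algebra ℂ F)
instance : StarModule ℂ N.Pre := inferInstanceAs (StarModule ℂ F)

/-- `N` as a seminorm on the type synonym. -/
def preSeminorm : Seminorm ℂ N.Pre := N.toSeminorm

instance : SeminormedRing N.Pre :=
  { (inferInstance : Ring N.Pre),
    N.preSeminorm.toAddGroupSeminorm.toSeminormedAddCommGroup with
    norm_mul_le := N.mul_le' }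

instance : NormedSpace ℂ N.Pre where
  norm_smul_le c x := (N.smul' c x).le

theorem norm_pre (x : N.Pre) : ‖x‖ = N.toSeminorm x := rfl

/-- The C⋆-algebra obtained from `F` by separation and completion with respect to `N`. -/
def Completion : Type v := UniformSpace.Completion N.Pre

namespace Completion

instance : NormedRing N.Completion := inferInstanceAs (NormedRing (UniformSpace.Completion N.Pre))

instance : CompleteSpace N.Completion :=
  inferInstanceAs (CompleteSpace (UniformSpace.Completion N.Pre))

instance : Algebra ℂ N.Completion :=
  inferInstanceAs (Algebra ℂ (UniformSpace.Completion N.Pre))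

instance : NormedAlgebra ℂ N.Completion where
  norm_smul_le c x := norm_smul_le (α := ℂ) (β := UniformSpace.Completion N.Pre) c x

theorem uniformContinuous_star : UniformContinuous (star : N.Pre → N.Pre) :=
  (AddMonoidHomClass.isometry_of_norm (starAddEquiv (R := N.Pre))
    (fun x : N.Pre => N.map_star x)).uniformContinuous

instance : Star N.Completion where
  star := UniformSpace.Completion.map (star : N.Pre → N.Pre)

/-- The canonical map into the completion. -/
def mk : N.Pre → N.Completion := fun x => (x : UniformSpace.Completion N.Pre)

theorem denseRange_mk : DenseRange (mk N) := UniformSpace.Completion.denseRange_coe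

theorem norm_mk (x : N.Pre) : ‖mk N x‖ = N x := UniformSpace.Completion.norm_coe x

theorem star_mk (x : N.Pre) : star (mk N x) = mk N (star x) :=
  UniformSpace.Completion.map_coe (uniformContinuous_star N) x

theorem mk_add (x y : N.Pre) : mk N (x + y) = mk N x + mk N y :=
  UniformSpace.Completion.coe_add x y

theorem mk_mul (x y : N.Pre) : mk N (x * y) = mk N x * mk N y :=
  UniformSpace.Completion.coe_mul x y

theorem mk_smul (c : ℂ) (x : N.Pre) : mk N (c • x) = c • mk N x :=
  UniformSpace.Completion.coe_smul c x

theorem continuous_star' : Continuous (star : N.Completion → N.Completion) :=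
  UniformSpace.Completion.continuous_map

instance : CStarAlgebra N.Completion where
  star_involutive x := by
    refine (denseRange_mk N).induction_on (p := fun x => star (star x) = x) x
      (isClosed_eq ((continuous_star' N).comp (continuous_star' N)) continuous_id) fun a => ?_
    simp [star_mk]
  star_mul x y := by
    refine (denseRange_mk N).induction_on₂ (p := fun x y => star (x * y) = star y * star x)
      (isClosed_eq ((continuous_star' N).comp continuous_mul)
      (((continuous_star' N).comp continuous_snd).mul ((continuous_star' N).comp continuous_fst)))
      (fun a b => ?_) x y
    simp [star_mk, ← mk_mul]
  star_add x y := by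
    refine (denseRange_mk N).induction_on₂ (p := fun x y => star (x + y) = star x + star y)
      (isClosed_eq ((continuous_star' N).comp continuous_add)
      (((continuous_star' N).comp continuous_fst).add ((continuous_star' N).comp continuous_snd)))
      (fun a b => ?_) x y
    simp [star_mk, ← mk_add]
  star_smul c x := by
    refine (denseRange_mk N).induction_on (p := fun x => star (c • x) = star c • star x) x
      (isClosed_eq ((continuous_star' N).comp (continuous_const_smul c))
      ((continuous_const_smul (star c)).comp (continuous_star' N))) fun a => ?_
    simp [star_mk, ← mk_smul]
  norm_mul_self_le x := by
    refine (denseRange_mk N).induction_on (p := fun x => ‖x‖ * ‖x‖ ≤ ‖star x * x‖) x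
      (isClosed_le (continuous_norm.mul continuous_norm)
      (((continuous_star' N).mul continuous_id).norm)) fun a => ?_
    rw [star_mk, ← mk_mul, norm_mk, norm_mk]
    exact (N.star_mul_self a).ge

end Completion

/-- The canonical ⋆-homomorphism of `F` into its completion. -/
def toCompletion : F →⋆ₐ[ℂ] N.Completion where
  toFun x := Completion.mk N x
  map_one' := rfl
  map_mul' := Completion.mk_mul N
  map_zero' := rfl
  map_add' := Completion.mk_add N
  commutes' _ := rfl
  map_star' x := (Completion.star_mk N x).symm

theorem norm_toCompletion (x : F) : ‖N.toCompletion x‖ = N x := Completion.norm_mk N x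

theorem denseRange_toCompletion : DenseRange N.toCompletion := Completion.denseRange_mk N

variable {N} {C : Type w} [CStarAlgebra C]

/-- A ⋆-homomorphism out of `F`, regarded as a ring homomorphism out of the seminormed ring. -/
def preHom (N : CStarSeminorm F) (f : F →⋆ₐ[ℂ] C) : N.Pre →+* C := ((f : F →ₐ[ℂ] C) : F →+* C)

theorem continuous_preHom (f : F →⋆ₐ[ℂ] C) (hf : ∀ x, ‖f x‖ ≤ N x) : Continuous (preHom N f) :=
  AddMonoidHomClass.continuous_of_bound (preHom N f) 1 fun x => by rw [one_mul]; exact hf x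

/-- The continuous extension of `f` to the completion, as a ring homomorphism. -/
def extend (f : F →⋆ₐ[ℂ] C) (hf : ∀ x, ‖f x‖ ≤ N x) : N.Completion →+* C :=
  UniformSpace.Completion.extensionHom (preHom N f) (continuous_preHom f hf)

theorem extend_toCompletion (f : F →⋆ₐ[ℂ] C) (hf : ∀ x, ‖f x‖ ≤ N x) (x : F) :
    extend f hf (N.toCompletion x) = f x :=
  UniformSpace.Completion.extensionHom_coe (preHom N f) (continuous_preHom f hf) x

theorem continuous_extend (f : F →⋆ₐ[ℂ] C) (hf : ∀ x, ‖f x‖ ≤ N x) : Continuous (extend f hf) :=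
  UniformSpace.Completion.continuous_extension

/-- Extension to the completion of a ⋆-homomorphism which is dominated by the seminorm. -/
def lift (f : F →⋆ₐ[ℂ] C) (hf : ∀ x, ‖f x‖ ≤ N x) : N.Completion →⋆ₐ[ℂ] C where
  toFun := extend f hf
  map_one' := map_one _
  map_mul' := map_mul _
  map_zero' := map_zero _
  map_add' := map_add _
  commutes' r := (extend_toCompletion f hf (algebraMap ℂ F r)).trans (AlgHomClass.commutes f r)
  map_star' x := by
    refine N.denseRange_toCompletion.induction_on
      (p := fun x => extend f hf (star x) = star (extend f hf x)) x
      (isClosed_eq ((continuous_extend f hf).comp continuous_star)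
        (continuous_extend f hf).star) fun a => ?_
    rw [← StarHomClass.map_star, extend_toCompletion, extend_toCompletion, StarHomClass.map_star]

theorem lift_toCompletion (f : F →⋆ₐ[ℂ] C) (hf : ∀ x, ‖f x‖ ≤ N x) (x : F) :
    lift f hf (N.toCompletion x) = f x := extend_toCompletion f hf x

end CStarSeminorm

/-! ### The free unital ⋆-algebra -/

/-- The free unital complex ⋆-algebra on `X`: the algebra of the free monoid on the letters
`Sum.inl x` (standing for `x`) and `Sum.inr x` (standing for the adjoint of `x`). -/
def FreeStarAlgebra (X : Type v) : Type v := MonoidAlgebra ℂ (FreeMonoid (X ⊕ X))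

namespace FreeStarAlgebra

variable {X : Type v}

instance : Ring (FreeStarAlgebra X) := inferInstanceAs (Ring (MonoidAlgebra ℂ (FreeMonoid (X ⊕ X))))
instance : Algebra ℂ (FreeStarAlgebra X) :=
  inferInstanceAs (Algebra ℂ (MonoidAlgebra ℂ (FreeMonoid (X ⊕ X))))

/-- The monomial `c • w` for a word `w` in the letters and their adjoints. -/
def monomial (w : FreeMonoid (X ⊕ X)) (c : ℂ) : FreeStarAlgebra X := MonoidAlgebra.single w c

theorem monomial_mul (w w' : FreeMonoid (X ⊕ X)) (c c' : ℂ) :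
    monomial w c * monomial w' c' = monomial (w * w') (c * c') :=
  MonoidAlgebra.single_mul_single ..

theorem algebraMap_eq (c : ℂ) : algebraMap ℂ (FreeStarAlgebra X) c = monomial 1 c := rfl

theorem smul_monomial (a : ℂ) (w : FreeMonoid (X ⊕ X)) (c : ℂ) :
    a • monomial w c = monomial w (a * c) := MonoidAlgebra.smul_single' ..

/-- The generator of the free ⋆-algebra which corresponds to `x`. -/
def gen (x : X) : FreeStarAlgebra X := monomial (FreeMonoid.of (Sum.inl x)) 1

theorem induction {p : FreeStarAlgebra X → Prop} (hm : ∀ w c, p (monomial w c))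
    (ha : ∀ x y, p x → p y → p (x + y)) (x : FreeStarAlgebra X) : p x := by
  refine MonoidAlgebra.induction_linear (motive := p) x ?_ ha hm
  have := hm 1 0
  rwa [monomial, MonoidAlgebra.single_zero] at this

/-- The adjoint of a word: reverse it and replace each letter by its adjoint. -/
def wordStar : FreeMonoid (X ⊕ X) →* (FreeMonoid (X ⊕ X))ᵐᵒᵖ :=
  FreeMonoid.lift fun y => MulOpposite.op (FreeMonoid.of y.swap)

theorem wordStar_wordStar (w : FreeMonoid (X ⊕ X)) : (wordStar (wordStar w).unop).unop = w := by
  induction w using FreeMonoid.inductionOn' with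
  | one => simp
  | of_mul y w ih =>
    rw [map_mul, MulOpposite.unop_mul, map_mul, MulOpposite.unop_mul, ih]
    simp [wordStar]

/-- The conjugate-linear ring homomorphism with prescribed values on words. -/
def conjLift {C : Type w} [Ring C] [Algebra ℂ C] (g : FreeMonoid (X ⊕ X) →* C) :
    FreeStarAlgebra X →+* C :=
  MonoidAlgebra.liftNCRingHom ((algebraMap ℂ C).comp (starRingEnd ℂ)) g
    fun _ _ => Algebra.commute_algebraMap_left _ _

theorem conjLift_monomial {C : Type w} [Ring C] [Algebra ℂ C] (g : FreeMonoid (X ⊕ X) →* C)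
    (w : FreeMonoid (X ⊕ X)) (c : ℂ) : conjLift g (monomial w c) = star c • g w :=
  (MonoidAlgebra.liftNC_single _ _ _ _).trans (Algebra.smul_def _ _).symm

/-- Words as elements of the free ⋆-algebra. -/
def ofWord : FreeMonoid (X ⊕ X) →* FreeStarAlgebra X := MonoidAlgebra.of ℂ (FreeMonoid (X ⊕ X))

/-- The conjugate-linear antiautomorphism which exchanges each letter with its adjoint. -/
def starHom : FreeStarAlgebra X →+* (FreeStarAlgebra X)ᵐᵒᵖ :=
  conjLift ((MonoidHom.op ofWord).comp wordStar)

instance : Star (FreeStarAlgebra X) := ⟨fun x => (starHom x).unop⟩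

theorem star_monomial (w : FreeMonoid (X ⊕ X)) (c : ℂ) :
    star (monomial w c) = monomial (wordStar w).unop (star c) := by
  refine (congrArg MulOpposite.unop (conjLift_monomial _ w c)).trans ?_
  change star c • monomial (wordStar w).unop 1 = _
  rw [smul_monomial, mul_one]

theorem star_add' (x y : FreeStarAlgebra X) : star (x + y) = star x + star y :=
  congrArg MulOpposite.unop (map_add starHom x y)

instance : StarRing (FreeStarAlgebra X) where
  star_involutive x := by
    induction x using induction with
    | hm w c => rw [star_monomial, star_monomial, wordStar_wordStar, star_star]
    | ha x y hx hy => rw [star_add', star_add', hx, hy]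
  star_mul x y := by
    exact congrArg MulOpposite.unop (map_mul starHom x y)
  star_add := star_add'

instance : StarModule ℂ (FreeStarAlgebra X) where
  star_smul a x := by
    induction x using induction with
    | hm w c => rw [smul_monomial, star_monomial, star_monomial, smul_monomial, star_mul']
    | ha x y hx hy => rw [smul_add, star_add, star_add, smul_add, hx, hy]

variable {C : Type w} [Ring C] [StarRing C]

/-- The value of a word when the letters are replaced by the elements `t x` and their adjoints. -/
def wordLift (t : X → C) : FreeMonoid (X ⊕ X) →* C :=
  FreeMonoid.lift (Sum.elim t fun x => star (t x))

theorem wordLift_wordStar (t : X → C) (w : FreeMonoid (X ⊕ X)) :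
    wordLift t (wordStar w).unop = star (wordLift t w) := by
  induction w using FreeMonoid.inductionOn' with
  | one => simp
  | of_mul y w ih =>
    rw [map_mul, MulOpposite.unop_mul, map_mul, ih, map_mul, star_mul]
    congr 1
    rcases y with x | x <;> simp [wordLift, wordStar]

/-- The homomorphism out of the free ⋆-algebra with prescribed values on the generators. -/
def liftAlgHom [Algebra ℂ C] (t : X → C) : FreeStarAlgebra X →ₐ[ℂ] C :=
  MonoidAlgebra.lift ℂ C (FreeMonoid (X ⊕ X)) (wordLift t)

theorem liftAlgHom_monomial [Algebra ℂ C] (t : X → C) (w : FreeMonoid (X ⊕ X)) (c : ℂ) :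
    liftAlgHom t (monomial w c) = c • wordLift t w := MonoidAlgebra.lift_single _ _ _

variable [Algebra ℂ C] [StarModule ℂ C]

/-- The ⋆-homomorphism out of the free ⋆-algebra with prescribed values on the generators. -/
def lift (t : X → C) : FreeStarAlgebra X →⋆ₐ[ℂ] C :=
  { liftAlgHom t with
    map_star' := fun x => by
      change liftAlgHom t (star x) = star (liftAlgHom t x)
      induction x using induction with
      | hm w c =>
        rw [star_monomial, liftAlgHom_monomial, liftAlgHom_monomial, wordLift_wordStar, star_smul]
      | ha x y hx hy => rw [star_add, map_add, map_add, hx, hy, star_add] }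

theorem lift_monomial (t : X → C) (w : FreeMonoid (X ⊕ X)) (c : ℂ) :
    lift t (monomial w c) = c • wordLift t w := liftAlgHom_monomial t w c

theorem lift_gen (t : X → C) (x : X) : lift t (gen x) = t x := by
  rw [gen, lift_monomial]; simp [wordLift]

end FreeStarAlgebra

/-! ### Cuntz-Krieger algebras -/

/-- Partial isometries `s 0, …, s (n - 1)` which satisfy the Cuntz-Krieger relations for `A`. -/
structure IsCuntzKriegerFamily {n : ℕ} (A : Matrix (Fin n) (Fin n) ℕ) {C : Type w} [Ring C]
    [StarRing C] (s : Fin n → C) : Prop where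
  partialIsometry : ∀ i, s i * star (s i) * s i = s i
  star_mul_self : ∀ i, star (s i) * s i = ∑ j, A i j • (s j * star (s j))
  sum_eq_one : ∑ i, s i * star (s i) = 1

theorem IsCuntzKriegerFamily.norm_le_one {n : ℕ} {A : Matrix (Fin n) (Fin n) ℕ} {C : Type w}
    [CStarAlgebra C] {s : Fin n → C} (hs : IsCuntzKriegerFamily A s) (i : Fin n) : ‖s i‖ ≤ 1 := by
  have h1 : star (s i) * s i = star (star (s i) * s i) * (star (s i) * s i) := by
    rw [star_mul, star_star, mul_assoc, ← mul_assoc (s i), hs.partialIsometry]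
  have h2 : ‖star (s i) * s i‖ = ‖star (s i) * s i‖ * ‖star (s i) * s i‖ := by
    conv_lhs => rw [h1, CStarRing.norm_star_mul_self]
  rw [CStarRing.norm_star_mul_self] at h2
  by_contra! h
  nlinarith [mul_pos (zero_lt_one.trans h) (zero_lt_one.trans h), mul_self_nonneg (‖s i‖ - 1)]

theorem IsCuntzKriegerFamily.map {n : ℕ} {A : Matrix (Fin n) (Fin n) ℕ} {C : Type w} {D : Type v}
    [CStarAlgebra C] [CStarAlgebra D] {s : Fin n → C} (hs : IsCuntzKriegerFamily A s)
    (f : C →⋆ₐ[ℂ] D) : IsCuntzKriegerFamily A fun i => f (s i) where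
  partialIsometry i := by rw [← map_star, ← map_mul, ← map_mul, hs.partialIsometry]
  star_mul_self i := by
    rw [← map_star, ← map_mul, hs.star_mul_self, map_sum]
    simp only [map_nsmul, map_mul, map_star]
  sum_eq_one := by
    rw [← map_one f, ← hs.sum_eq_one, map_sum]
    simp only [map_mul, map_star]

namespace CuntzKrieger

variable {n : ℕ} (A : Matrix (Fin n) (Fin n) ℕ)

/-- The C⋆-seminorms on the free ⋆-algebra under which the generators satisfy the Cuntz-Krieger
relations for `A`. -/
def Admissible : Type :=
  {N : CStarSeminorm (FreeStarAlgebra (Fin n)) //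
    IsCuntzKriegerFamily A fun i => N.toCompletion (FreeStarAlgebra.gen i)}

theorem bddAbove (x : FreeStarAlgebra (Fin n)) :
    BddAbove (Set.range fun N : Admissible A => N.1 x) := by
  suffices h : ∃ K : ℝ, ∀ N : Admissible A, N.1 x ≤ K by
    obtain ⟨K, hK⟩ := h
    exact ⟨K, by rintro _ ⟨N, rfl⟩; exact hK N⟩
  induction x using FreeStarAlgebra.induction with
  | ha x y hx hy =>
    obtain ⟨K, hK⟩ := hx
    obtain ⟨L, hL⟩ := hy
    exact ⟨K + L, fun N => (map_add_le_add N.1.toSeminorm x y).trans (add_le_add (hK N) (hL N))⟩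
  | hm w c =>
    refine ⟨‖c‖, fun N => ?_⟩
    have hone : N.1 1 ≤ 1 := by
      have h := N.1.star_mul_self 1
      rw [star_one, one_mul] at h
      nlinarith [mul_self_nonneg (N.1 1 - 1), mul_self_nonneg (N.1 1 + 1)]
    have hgen : ∀ i, N.1 (FreeStarAlgebra.gen i) ≤ 1 := fun i => by
      rw [← CStarSeminorm.norm_toCompletion]; exact N.2.norm_le_one i
    have hword : ∀ w, N.1 (FreeStarAlgebra.monomial w 1) ≤ 1 := fun w => by
      induction w using FreeMonoid.inductionOn' with
      | one => exact hone
      | of_mul y w ih =>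
        have hy : N.1 (FreeStarAlgebra.monomial (FreeMonoid.of y) 1) ≤ 1 := by
          rcases y with i | i
          · exact hgen i
          · have h : FreeStarAlgebra.monomial (FreeMonoid.of (Sum.inr i)) 1 =
                star (FreeStarAlgebra.gen i) := by
              rw [FreeStarAlgebra.gen, FreeStarAlgebra.star_monomial]
              simp [FreeStarAlgebra.wordStar]
            rw [h, N.1.map_star]; exact hgen i
        have h := N.1.mul_le (FreeStarAlgebra.monomial (FreeMonoid.of y) 1)
          (FreeStarAlgebra.monomial w 1)
        rw [FreeStarAlgebra.monomial_mul, one_mul] at h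
        exact h.trans (mul_le_one₀ hy (N.1.nonneg _) ih)
    have h : FreeStarAlgebra.monomial w c = c • FreeStarAlgebra.monomial w 1 := by
      rw [FreeStarAlgebra.smul_monomial, mul_one]
    rw [h, map_smul_eq_mul]
    exact mul_le_of_le_one_right (norm_nonneg c) (hword w)

/-- The largest C⋆-seminorm on the free ⋆-algebra under which the generators satisfy the
Cuntz-Krieger relations for `A`. -/
def universalSeminorm : CStarSeminorm (FreeStarAlgebra (Fin n)) :=
  CStarSeminorm.iSup (fun N : Admissible A => N.1) (bddAbove A)

end CuntzKrieger

/-- The Cuntz-Krieger algebra `𝒪_A`: the universal unital C⋆-algebra generated by partial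
isometries which satisfy the Cuntz-Krieger relations for `A`. -/
def CuntzKrieger {n : ℕ} (A : Matrix (Fin n) (Fin n) ℕ) : Type :=
  (CuntzKrieger.universalSeminorm A).Completion

namespace CuntzKrieger

variable {n : ℕ} (A : Matrix (Fin n) (Fin n) ℕ)

instance : CStarAlgebra (CuntzKrieger A) :=
  inferInstanceAs (CStarAlgebra (universalSeminorm A).Completion)

/-- The canonical generators of `𝒪_A`. -/
def s (i : Fin n) : CuntzKrieger A :=
  (universalSeminorm A).toCompletion (FreeStarAlgebra.gen i)

theorem toCompletion_eq {x y : FreeStarAlgebra (Fin n)}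
    (h : ∀ N : Admissible A, N.1.toCompletion x = N.1.toCompletion y) :
    (universalSeminorm A).toCompletion x = (universalSeminorm A).toCompletion y := by
  rw [← sub_eq_zero, ← norm_eq_zero, ← map_sub, CStarSeminorm.norm_toCompletion]
  refine le_antisymm (Real.iSup_le (fun N => ?_) le_rfl) (CStarSeminorm.nonneg _ _)
  rw [← CStarSeminorm.norm_toCompletion, map_sub, h, sub_self, norm_zero]

theorem isCuntzKriegerFamily_s : IsCuntzKriegerFamily A (s A) where
  partialIsometry i := by
    have h := toCompletion_eq A (x := .gen i * star (.gen i) * .gen i) (y := .gen i)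
      fun N => by simpa [map_star] using N.2.partialIsometry i
    simpa [map_star] using! h
  star_mul_self i := by
    have h := toCompletion_eq A (x := star (.gen i) * .gen i)
      (y := ∑ j, A i j • (.gen j * star (.gen j)))
      fun N => by simpa [map_star] using N.2.star_mul_self i
    simpa [map_star] using! h
  sum_eq_one := by
    have h := toCompletion_eq A (x := ∑ i, .gen i * star (.gen i)) (y := 1)
      fun N => by simpa [map_star] using N.2.sum_eq_one
    simpa [map_star] using! h

variable {A} {C : Type w} [CStarAlgebra C] {t : Fin n → C}

theorem norm_lift_le (ht : IsCuntzKriegerFamily A t) (x : FreeStarAlgebra (Fin n)) :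
    ‖FreeStarAlgebra.lift t x‖ ≤ universalSeminorm A x := by
  let N : CStarSeminorm (FreeStarAlgebra (Fin n)) := CStarSeminorm.ofHom (FreeStarAlgebra.lift t)
  have hN : ∀ {x y : FreeStarAlgebra (Fin n)},
      FreeStarAlgebra.lift t x = FreeStarAlgebra.lift t y →
        N.toCompletion x = N.toCompletion y := fun {x y} h => by
    rw [← sub_eq_zero, ← norm_eq_zero, ← map_sub, CStarSeminorm.norm_toCompletion]
    change ‖FreeStarAlgebra.lift t (x - y)‖ = 0
    rw [map_sub, h, sub_self, norm_zero]
  have hadm : IsCuntzKriegerFamily A fun i => N.toCompletion (FreeStarAlgebra.gen i) :=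
    { partialIsometry := fun i => by
        have h := hN (x := .gen i * star (.gen i) * .gen i) (y := .gen i)
          (by simpa [map_star, FreeStarAlgebra.lift_gen] using ht.partialIsometry i)
        simpa [map_star] using h
      star_mul_self := fun i => by
        have h := hN (x := star (.gen i) * .gen i) (y := ∑ j, A i j • (.gen j * star (.gen j)))
          (by simpa [map_star, FreeStarAlgebra.lift_gen] using ht.star_mul_self i)
        simpa [map_star] using h
      sum_eq_one := by
        have h := hN (x := ∑ i, .gen i * star (.gen i)) (y := 1)
          (by simpa [map_star, FreeStarAlgebra.lift_gen] using ht.sum_eq_one)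
        simpa [map_star] using h }
  exact CStarSeminorm.le_iSup _ (bddAbove A) (⟨N, hadm⟩ : Admissible A) x

/-- The universal property of `𝒪_A`: the ⋆-homomorphism which maps the canonical generators to a
given Cuntz-Krieger family. -/
def lift (t : Fin n → C) (ht : IsCuntzKriegerFamily A t) : CuntzKrieger A →⋆ₐ[ℂ] C :=
  CStarSeminorm.lift (FreeStarAlgebra.lift t) (norm_lift_le ht)

theorem lift_s (ht : IsCuntzKriegerFamily A t) (i : Fin n) : lift t ht (s A i) = t i :=
  (CStarSeminorm.lift_toCompletion _ _ _).trans (FreeStarAlgebra.lift_gen t i)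

/-- Two ⋆-homomorphisms out of `𝒪_A` which agree on the canonical generators are equal. -/
theorem hom_ext {f g : CuntzKrieger A →⋆ₐ[ℂ] C} (h : ∀ i, f (s A i) = g (s A i)) : f = g := by
  have hf : ∀ k : CuntzKrieger A →⋆ₐ[ℂ] C, Continuous k := fun k =>
    AddMonoidHomClass.continuous_of_bound k 1
      fun x => by rw [one_mul]; exact NonUnitalStarAlgHom.norm_apply_le k x
  refine DFunLike.coe_injective ((universalSeminorm A).denseRange_toCompletion.equalizer
    (hf f) (hf g) (funext fun x => ?_))
  let ι : FreeStarAlgebra (Fin n) →⋆ₐ[ℂ] CuntzKrieger A := (universalSeminorm A).toCompletion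
  change f (ι x) = g (ι x)
  have hι : ∀ i, f (ι (.gen i)) = g (ι (.gen i)) := h
  induction x using FreeStarAlgebra.induction with
  | ha x y hx hy => rw [map_add, map_add, map_add, hx, hy]
  | hm w c =>
    have hc : FreeStarAlgebra.monomial w c = c • FreeStarAlgebra.monomial w 1 := by
      rw [FreeStarAlgebra.smul_monomial, mul_one]
    rw [hc, map_smul, map_smul, map_smul]
    congr 1
    induction w using FreeMonoid.inductionOn' with
    | one => exact (congrArg f (map_one ι)).trans ((map_one f).trans
        ((map_one g).symm.trans (congrArg g (map_one ι)).symm))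
    | of_mul y w ih =>
      have hw := FreeStarAlgebra.monomial_mul (FreeMonoid.of y) w 1 1
      rw [one_mul] at hw
      rw [← hw, map_mul, map_mul, map_mul, ih (by
        rw [FreeStarAlgebra.smul_monomial, mul_one])]
      congr 1
      rcases y with i | i
      · exact hι i
      · have hs : FreeStarAlgebra.monomial (FreeMonoid.of (Sum.inr i)) 1 =
            star (FreeStarAlgebra.gen i) := by
          rw [FreeStarAlgebra.gen, FreeStarAlgebra.star_monomial]
          simp [FreeStarAlgebra.wordStar]
        rw [hs, map_star, map_star, map_star, hι]

end CuntzKrieger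

/-! ### Representations -/

/-- A unital ⋆-representation of `𝒜` on a complex Hilbert space. -/
structure HilbertRep (𝒜 : Type v) [CStarAlgebra 𝒜] where
  carrier : Type u
  [normedAddCommGroup : NormedAddCommGroup carrier]
  [innerProductSpace : InnerProductSpace ℂ carrier]
  [completeSpace : CompleteSpace carrier]
  toHom : 𝒜 →⋆ₐ[ℂ] (carrier →L[ℂ] carrier)

namespace HilbertRep

attribute [instance] normedAddCommGroup innerProductSpace completeSpace

variable {𝒜 : Type v} [CStarAlgebra 𝒜] {ℬ : Type w} [CStarAlgebra ℬ]

/-- The representation `π ∘ f`. -/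
abbrev comp (π : HilbertRep.{u} 𝒜) (f : ℬ →⋆ₐ[ℂ] 𝒜) : HilbertRep.{u} ℬ where
  carrier := π.carrier
  toHom := π.toHom.comp f

/-- The von Neumann algebra `π(𝒜)''` generated by the representation `π`. -/
def vonNeumann (π : HilbertRep.{u} 𝒜) : VonNeumannAlgebra π.carrier where
  toStarSubalgebra := StarSubalgebra.centralizer ℂ (Set.centralizer (Set.range π.toHom))
  centralizer_centralizer' := by
    change Set.centralizer (Set.centralizer (Set.centralizer _)) = Set.centralizer _
    rw [Set.centralizer_centralizer_centralizer]

theorem coe_vonNeumann (π : HilbertRep.{u} 𝒜) :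
    (π.vonNeumann : Set (π.carrier →L[ℂ] π.carrier)) =
      Set.centralizer (Set.centralizer (Set.range π.toHom)) := by
  have h : star (Set.range π.toHom) = Set.range π.toHom := by
    ext x
    constructor
    · rintro ⟨a, ha⟩
      exact ⟨star a, by rw [map_star, ha, star_star]⟩
    · rintro ⟨a, rfl⟩
      exact ⟨star a, map_star _ _⟩
  have h' : star (Set.centralizer (Set.range π.toHom)) = Set.centralizer (Set.range π.toHom) := by
    conv_rhs => rw [← h]
    ext x
    constructor
    · intro hx y hy
      have := congrArg star (hx (star y) hy)
      simpa using this.symm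
    · intro hx y hy
      have := congrArg star (hx (star y) (by simpa using hy))
      simpa using this.symm
  change Set.centralizer (_ ∪ star (Set.centralizer (Set.range π.toHom))) = _
  rw [h', Set.union_self]

theorem mem_vonNeumann (π : HilbertRep.{u} 𝒜) (x : 𝒜) :
    π.toHom x ∈ π.vonNeumann.toStarSubalgebra := by
  change π.toHom x ∈ (π.vonNeumann : Set (π.carrier →L[ℂ] π.carrier))
  rw [coe_vonNeumann]
  exact Set.subset_centralizer_centralizer ⟨x, rfl⟩

/-- `π` is a factor representation: `π(𝒜)''` is a factor, i.e. it acts on a nonzero space and its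
center consists of the scalars. -/
def IsFactorRep (π : HilbertRep.{u} 𝒜) : Prop :=
  Nontrivial π.carrier ∧
    ∀ z ∈ π.vonNeumann, z ∈ π.vonNeumann.commutant → ∃ c : ℂ, z = c • 1

/-- Quasi-equivalence: there is a ⋆-isomorphism `π₁(𝒜)'' ≃ π₂(𝒜)''` which maps `π₁ x` to `π₂ x`. -/
def QuasiEquiv (π₁ π₂ : HilbertRep.{u} 𝒜) : Prop :=
  ∃ f : π₁.vonNeumann.toStarSubalgebra ≃⋆ₐ[ℂ] π₂.vonNeumann.toStarSubalgebra,
    ∀ x : 𝒜, (f ⟨π₁.toHom x, π₁.mem_vonNeumann x⟩ : π₂.carrier →L[ℂ] π₂.carrier) = π₂.toHom x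

end HilbertRep

/-! ### Tensor products of operators -/

section HilbertTensor

variable (H : Type v) (K : Type w) [NormedAddCommGroup H] [InnerProductSpace ℂ H]
  [NormedAddCommGroup K] [InnerProductSpace ℂ K]

/-- The Hilbert space tensor product: the completion of the algebraic tensor product. -/
def HilbertTensor : Type (max v w) := UniformSpace.Completion (H ⊗[ℂ] K)

namespace HilbertTensor

instance : NormedAddCommGroup (HilbertTensor H K) :=
  inferInstanceAs (NormedAddCommGroup (UniformSpace.Completion (H ⊗[ℂ] K)))

instance : InnerProductSpace ℂ (HilbertTensor H K) :=
  inferInstanceAs (InnerProductSpace ℂ (UniformSpace.Completion (H ⊗[ℂ] K)))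

instance : CompleteSpace (HilbertTensor H K) :=
  inferInstanceAs (CompleteSpace (UniformSpace.Completion (H ⊗[ℂ] K)))

variable {H K}

/-- The inclusion of the algebraic into the Hilbert space tensor product. -/
def incl : H ⊗[ℂ] K →ₗᵢ[ℂ] HilbertTensor H K := UniformSpace.Completion.toComplₗᵢ

theorem denseRange_incl : DenseRange (incl : H ⊗[ℂ] K → HilbertTensor H K) :=
  UniformSpace.Completion.denseRange_coe

theorem norm_incl_tmul (x : H) (y : K) : ‖incl (x ⊗ₜ[ℂ] y)‖ = ‖x‖ * ‖y‖ := by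
  rw [LinearIsometry.norm_map, TensorProduct.norm_tmul]

theorem clm_ext {f g : HilbertTensor H K →L[ℂ] HilbertTensor H K}
    (h : ∀ x : H ⊗[ℂ] K, f (incl x) = g (incl x)) : f = g :=
  DFunLike.coe_injective (denseRange_incl.equalizer f.continuous g.continuous (funext h))

end HilbertTensor

variable {H K}

/-- The operator `S ⊗ T` on the Hilbert space tensor product. -/
def tensorOp (S : H →L[ℂ] H) (T : K →L[ℂ] K) : HilbertTensor H K →L[ℂ] HilbertTensor H K :=
  (TensorProduct.mapL S T).completion

theorem tensorOp_incl (S : H →L[ℂ] H) (T : K →L[ℂ] K) (x : H ⊗[ℂ] K) :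
    tensorOp S T (HilbertTensor.incl x) = HilbertTensor.incl (TensorProduct.mapL S T x) :=
  ContinuousLinearMap.completion_apply_coe _ _

theorem tensorOp_mul (S S' : H →L[ℂ] H) (T T' : K →L[ℂ] K) :
    tensorOp (S * S') (T * T') = tensorOp S T * tensorOp S' T' := by
  refine HilbertTensor.clm_ext fun x => ?_
  rw [mul_apply_eq_comp, tensorOp_incl, tensorOp_incl, tensorOp_incl,
    TensorProduct.mapL_mul, mul_apply_eq_comp]

theorem tensorOp_one : tensorOp (1 : H →L[ℂ] H) (1 : K →L[ℂ] K) = 1 := by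
  refine HilbertTensor.clm_ext fun x => ?_
  rw [tensorOp_incl]
  exact congrArg _ (congrArg (fun f : H ⊗[ℂ] K →L[ℂ] H ⊗[ℂ] K => f x) TensorProduct.mapL_id_id)

theorem tensorOp_add_left (S S' : H →L[ℂ] H) (T : K →L[ℂ] K) :
    tensorOp (S + S') T = tensorOp S T + tensorOp S' T := by
  refine HilbertTensor.clm_ext fun x => ?_
  rw [add_apply, tensorOp_incl, tensorOp_incl, tensorOp_incl,
    TensorProduct.mapL_add_left, add_apply, map_add]

theorem tensorOp_add_right (S : H →L[ℂ] H) (T T' : K →L[ℂ] K) :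
    tensorOp S (T + T') = tensorOp S T + tensorOp S T' := by
  refine HilbertTensor.clm_ext fun x => ?_
  rw [add_apply, tensorOp_incl, tensorOp_incl, tensorOp_incl,
    TensorProduct.mapL_add_right, add_apply, map_add]

theorem tensorOp_smul_left (c : ℂ) (S : H →L[ℂ] H) (T : K →L[ℂ] K) :
    tensorOp (c • S) T = c • tensorOp S T := by
  refine HilbertTensor.clm_ext fun x => ?_
  rw [smul_apply, tensorOp_incl, tensorOp_incl,
    TensorProduct.mapL_smul_left, smul_apply, map_smul]

theorem tensorOp_smul_right (c : ℂ) (S : H →L[ℂ] H) (T : K →L[ℂ] K) :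
    tensorOp S (c • T) = c • tensorOp S T := by
  refine HilbertTensor.clm_ext fun x => ?_
  rw [smul_apply, tensorOp_incl, tensorOp_incl,
    TensorProduct.mapL_smul_right, smul_apply, map_smul]

theorem inner_mapL [CompleteSpace H] [CompleteSpace K] (S : H →L[ℂ] H) (T : K →L[ℂ] K)
    (x y : H ⊗[ℂ] K) :
    inner ℂ (TensorProduct.mapL (star S) (star T) x) y = inner ℂ x (TensorProduct.mapL S T y) := by
  induction x with
  | zero => simp
  | add x x' hx hx' => rw [map_add, inner_add_left, inner_add_left, hx, hx']
  | tmul a b =>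
    induction y with
    | zero => simp
    | add y y' hy hy' => rw [map_add, inner_add_right, inner_add_right, hy, hy']
    | tmul c d =>
      rw [TensorProduct.mapL_tmul, TensorProduct.mapL_tmul, TensorProduct.inner_tmul,
        TensorProduct.inner_tmul, ContinuousLinearMap.star_eq_adjoint,
        ContinuousLinearMap.star_eq_adjoint, ContinuousLinearMap.adjoint_inner_left,
        ContinuousLinearMap.adjoint_inner_left]

theorem tensorOp_star [CompleteSpace H] [CompleteSpace K] (S : H →L[ℂ] H) (T : K →L[ℂ] K) :
    tensorOp (star S) (star T) = star (tensorOp S T) := by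
  rw [ContinuousLinearMap.star_eq_adjoint (tensorOp S T), ContinuousLinearMap.eq_adjoint_iff]
  intro x y
  refine HilbertTensor.denseRange_incl.induction_on₂
    (p := fun x y => inner ℂ (tensorOp (star S) (star T) x) y = inner ℂ x (tensorOp S T y))
    (by apply isClosed_eq <;> fun_prop) (fun x y => ?_) x y
  rw [tensorOp_incl, tensorOp_incl, LinearIsometry.inner_map_map, LinearIsometry.inner_map_map,
    inner_mapL]

end HilbertTensor

namespace HilbertRep

variable {𝒜 : Type v} [CStarAlgebra 𝒜] {ℬ : Type w} [CStarAlgebra ℬ]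

/-- The representation `π₁ ⊗ π₂` of the algebraic tensor product, as an algebra homomorphism. -/
def tensorAlgHom (π₁ : HilbertRep.{u} 𝒜) (π₂ : HilbertRep.{u} ℬ) :
    𝒜 ⊗[ℂ] ℬ →ₐ[ℂ]
      (HilbertTensor π₁.carrier π₂.carrier →L[ℂ] HilbertTensor π₁.carrier π₂.carrier) :=
  Algebra.TensorProduct.algHomOfLinearMapTensorProduct
    (TensorProduct.lift (LinearMap.mk₂ ℂ (fun a b => tensorOp (π₁.toHom a) (π₂.toHom b))
      (fun a a' b => by rw [map_add, tensorOp_add_left])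
      (fun c a b => by rw [map_smul, tensorOp_smul_left])
      (fun a b b' => by rw [map_add, tensorOp_add_right])
      (fun c a b => by rw [map_smul, tensorOp_smul_right])))
    (fun a a' b b' => by
      simp only [TensorProduct.lift.tmul, LinearMap.mk₂_apply]
      rw [map_mul, map_mul, tensorOp_mul])
    (by simp only [TensorProduct.lift.tmul, LinearMap.mk₂_apply, map_one, tensorOp_one])

theorem tensorAlgHom_tmul (π₁ : HilbertRep.{u} 𝒜) (π₂ : HilbertRep.{u} ℬ) (a : 𝒜) (b : ℬ) :
    tensorAlgHom π₁ π₂ (a ⊗ₜ b) = tensorOp (π₁.toHom a) (π₂.toHom b) := rfl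

/-- The representation `π₁ ⊗ π₂` of the algebraic tensor product, `a ⊗ b ↦ π₁ a ⊗ π₂ b`. -/
def tensorHom (π₁ : HilbertRep.{u} 𝒜) (π₂ : HilbertRep.{u} ℬ) :
    𝒜 ⊗[ℂ] ℬ →⋆ₐ[ℂ]
      (HilbertTensor π₁.carrier π₂.carrier →L[ℂ] HilbertTensor π₁.carrier π₂.carrier) :=
  { tensorAlgHom π₁ π₂ with
    map_star' := fun x => by
      change tensorAlgHom π₁ π₂ (star x) = star (tensorAlgHom π₁ π₂ x)
      induction x with
      | zero => simp
      | add x y hx hy => rw [star_add, map_add, map_add, hx, hy, star_add]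
      | tmul a b =>
        rw [TensorProduct.star_tmul, tensorAlgHom_tmul, tensorAlgHom_tmul, map_star, map_star,
          tensorOp_star] }

theorem tensorHom_tmul (π₁ : HilbertRep.{u} 𝒜) (π₂ : HilbertRep.{u} ℬ) (a : 𝒜) (b : ℬ) :
    tensorHom π₁ π₂ (a ⊗ₜ b) = tensorOp (π₁.toHom a) (π₂.toHom b) := rfl

/-- The C⋆-seminorm `x ↦ ‖(π₁ ⊗ π₂) x‖` on the algebraic tensor product. -/
def tensorSeminorm (π₁ : HilbertRep.{u} 𝒜) (π₂ : HilbertRep.{u} ℬ) : CStarSeminorm (𝒜 ⊗[ℂ] ℬ) :=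
  CStarSeminorm.ofHom
    (C := HilbertTensor π₁.carrier π₂.carrier →L[ℂ] HilbertTensor π₁.carrier π₂.carrier)
    (tensorHom π₁ π₂)

end HilbertRep

/-! ### The minimal tensor product -/

namespace MinTensor

variable (𝒜 : Type v) [CStarAlgebra 𝒜] (ℬ : Type w) [CStarAlgebra ℬ]

theorem norm_toHom_le {𝒜 : Type v} [CStarAlgebra 𝒜] (π : HilbertRep.{u} 𝒜) (a : 𝒜) :
    ‖π.toHom a‖ ≤ ‖a‖ := NonUnitalStarAlgHom.norm_apply_le π.toHom a

theorem bddAbove (x : 𝒜 ⊗[ℂ] ℬ) :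
    BddAbove (Set.range fun π : HilbertRep.{u} 𝒜 × HilbertRep.{u} ℬ =>
      HilbertRep.tensorSeminorm π.1 π.2 x) := by
  suffices h : ∃ C : ℝ, ∀ π : HilbertRep.{u} 𝒜 × HilbertRep.{u} ℬ,
      ‖HilbertRep.tensorHom π.1 π.2 x‖ ≤ C by
    obtain ⟨C, hC⟩ := h
    exact ⟨C, by rintro _ ⟨π, rfl⟩; exact hC π⟩
  induction x with
  | zero => exact ⟨0, fun π => by simp⟩
  | add x y hx hy =>
    obtain ⟨C, hC⟩ := hx
    obtain ⟨D, hD⟩ := hy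
    exact ⟨C + D, fun π => by
      rw [map_add]; exact (norm_add_le _ _).trans (add_le_add (hC π) (hD π))⟩
  | tmul a b =>
    have hl : ∀ π : HilbertRep.{u} 𝒜 × HilbertRep.{u} ℬ,
        ‖HilbertRep.tensorHom π.1 π.2 (a ⊗ₜ b)‖ ≤ ‖a‖ * ‖b‖ := fun π => by
      rw [HilbertRep.tensorHom_tmul]
      refine ContinuousLinearMap.opNorm_le_bound _ (by positivity) fun z => ?_
      refine HilbertTensor.denseRange_incl.induction_on
        (p := fun z => ‖tensorOp (π.1.toHom a) (π.2.toHom b) z‖ ≤ ‖a‖ * ‖b‖ * ‖z‖) z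
        (by apply isClosed_le <;> fun_prop) fun z => ?_
      rw [tensorOp_incl, LinearIsometry.norm_map, LinearIsometry.norm_map]
      refine (ContinuousLinearMap.le_opNorm _ _).trans ?_
      refine mul_le_mul_of_nonneg_right ?_ (norm_nonneg z)
      refine (TensorProduct.norm_mapL_le _ _).trans ?_
      exact mul_le_mul (norm_toHom_le _ _) (norm_toHom_le _ _) (norm_nonneg _) (norm_nonneg _)
    exact ⟨_, hl⟩

/-- The minimal (spatial) C⋆-norm on the algebraic tensor product:
`‖x‖ = sup ‖(π₁ ⊗ π₂) x‖` over all representations `π₁` of `𝒜` and `π₂` of `ℬ`. -/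
def seminorm : CStarSeminorm (𝒜 ⊗[ℂ] ℬ) :=
  CStarSeminorm.iSup
    (fun π : HilbertRep.{u} 𝒜 × HilbertRep.{u} ℬ =>
      HilbertRep.tensorSeminorm π.1 π.2)
    (bddAbove 𝒜 ℬ)

end MinTensor

/-- The minimal (spatial) C⋆-tensor product of two unital C⋆-algebras. -/
def MinTensor (𝒜 : Type v) [CStarAlgebra 𝒜] (ℬ : Type w) [CStarAlgebra ℬ] : Type (max v w) :=
  (MinTensor.seminorm.{u} 𝒜 ℬ).Completion

namespace MinTensor

variable {𝒜 : Type v} [CStarAlgebra 𝒜] {ℬ : Type w} [CStarAlgebra ℬ]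

instance : CStarAlgebra (MinTensor.{u} 𝒜 ℬ) :=
  inferInstanceAs (CStarAlgebra (MinTensor.seminorm.{u} 𝒜 ℬ).Completion)

/-- The canonical ⋆-homomorphism of the algebraic into the minimal tensor product. -/
def ofAlg : 𝒜 ⊗[ℂ] ℬ →⋆ₐ[ℂ] MinTensor.{u} 𝒜 ℬ := (MinTensor.seminorm.{u} 𝒜 ℬ).toCompletion

/-- The elementary tensor `a ⊗ b` in the minimal tensor product. -/
def tmul (a : 𝒜) (b : ℬ) : MinTensor.{u} 𝒜 ℬ := ofAlg (a ⊗ₜ b)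

end MinTensor

/-- The representation `π₁ ⊗ π₂` of the minimal tensor product on the Hilbert space tensor
product. -/
abbrev HilbertRep.minTensor {𝒜 : Type v} [CStarAlgebra 𝒜] {ℬ : Type w} [CStarAlgebra ℬ]
    (π₁ : HilbertRep.{u} 𝒜) (π₂ : HilbertRep.{u} ℬ) : HilbertRep.{u} (MinTensor.{u} 𝒜 ℬ) where
  carrier := HilbertTensor π₁.carrier π₂.carrier
  toHom := CStarSeminorm.lift (HilbertRep.tensorHom π₁ π₂)
    (CStarSeminorm.le_iSup _ (MinTensor.bddAbove 𝒜 ℬ) (π₁, π₂))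

theorem HilbertRep.minTensor_tmul {𝒜 : Type v} [CStarAlgebra 𝒜] {ℬ : Type w} [CStarAlgebra ℬ]
    (π₁ : HilbertRep.{u} 𝒜) (π₂ : HilbertRep.{u} ℬ) (a : 𝒜) (b : ℬ) :
    (π₁.minTensor π₂).toHom (MinTensor.tmul a b) = tensorOp (π₁.toHom a) (π₂.toHom b) :=
  CStarSeminorm.lift_toCompletion _ _ _

namespace HilbertRep

variable {𝒜 : Type v} [CStarAlgebra 𝒜] {ℬ : Type w} [CStarAlgebra ℬ]
  (π₁ : HilbertRep.{u} 𝒜) (π₂ : HilbertRep.{u} ℬ)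

/-- The elementary tensor `ξ ⊗ η` in the space of `π₁ ⊗ π₂`. -/
def tmulVec (ξ : π₁.carrier) (η : π₂.carrier) : (π₁.minTensor π₂).carrier :=
  HilbertTensor.incl (ξ ⊗ₜ η)

theorem norm_tmulVec (ξ : π₁.carrier) (η : π₂.carrier) : ‖tmulVec π₁ π₂ ξ η‖ = ‖ξ‖ * ‖η‖ :=
  HilbertTensor.norm_incl_tmul ξ η

theorem inner_tmulVec (ξ ξ' : π₁.carrier) (η η' : π₂.carrier) :
    inner ℂ (tmulVec π₁ π₂ ξ η) (tmulVec π₁ π₂ ξ' η') = inner ℂ ξ ξ' * inner ℂ η η' :=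
  (LinearIsometry.inner_map_map HilbertTensor.incl (ξ ⊗ₜ[ℂ] η) (ξ' ⊗ₜ[ℂ] η')).trans
    (TensorProduct.inner_tmul ..)

theorem minTensor_tmul_tmulVec (a : 𝒜) (b : ℬ) (ξ : π₁.carrier) (η : π₂.carrier) :
    (π₁.minTensor π₂).toHom (MinTensor.tmul a b) (tmulVec π₁ π₂ ξ η) =
      tmulVec π₁ π₂ (π₁.toHom a ξ) (π₂.toHom b η) :=
  (congrArg (fun T => T (tmulVec π₁ π₂ ξ η)) (minTensor_tmul π₁ π₂ a b)).trans
    (tensorOp_incl (π₁.toHom a) (π₂.toHom b) (ξ ⊗ₜ[ℂ] η))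

end HilbertRep

/-! ### States -/

/-- A state on a unital C⋆-algebra. -/
structure CStarState (𝒜 : Type v) [CStarAlgebra 𝒜] extends 𝒜 →ₗ[ℂ] ℂ where
  nonneg' : ∀ x : 𝒜, 0 ≤ toFun (star x * x)
  map_one' : toFun 1 = 1

namespace CStarState

variable {𝒜 : Type v} [CStarAlgebra 𝒜] {ℬ : Type w} [CStarAlgebra ℬ]

instance : CoeFun (CStarState 𝒜) (fun _ => 𝒜 → ℂ) := ⟨fun ρ => ρ.toLinearMap⟩

/-- The state `ρ ∘ f`. -/
def comp (ρ : CStarState 𝒜) (f : ℬ →⋆ₐ[ℂ] 𝒜) : CStarState ℬ where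
  toLinearMap := ρ.toLinearMap ∘ₗ (f : ℬ →ₐ[ℂ] 𝒜).toLinearMap
  nonneg' x := by
    change 0 ≤ ρ (f (star x * x))
    rw [map_mul, map_star]; exact ρ.nonneg' _
  map_one' := by
    change ρ (f 1) = 1
    rw [map_one]; exact ρ.map_one'

/-- The vector state `x ↦ ⟪ξ, π x ξ⟫` of a unit vector `ξ`. -/
def ofVector (π : HilbertRep.{u} 𝒜) (ξ : π.carrier) (hξ : ‖ξ‖ = 1) : CStarState 𝒜 where
  toFun x := inner ℂ ξ (π.toHom x ξ)
  map_add' x y := by rw [map_add, add_apply, inner_add_right]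
  map_smul' c x := by rw [map_smul, smul_apply, inner_smul_right]; rfl
  nonneg' x := by
    rw [map_mul, map_star, mul_apply_eq_comp, ContinuousLinearMap.star_eq_adjoint,
      ContinuousLinearMap.adjoint_inner_right, inner_self_eq_norm_sq_to_K]
    exact pow_nonneg (Complex.zero_le_real.mpr (norm_nonneg (π.toHom x ξ))) 2
  map_one' := by
    rw [map_one, one_apply_eq_self, inner_self_eq_norm_sq_to_K, hξ]; simp

theorem ofVector_apply (π : HilbertRep.{u} 𝒜) (ξ : π.carrier) (hξ : ‖ξ‖ = 1) (x : 𝒜) :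
    ofVector π ξ hξ x = inner ℂ ξ (π.toHom x ξ) := rfl

section GNS

variable [PartialOrder 𝒜] [StarOrderedRing 𝒜]

/-- A state as a positive linear functional on the ordered space `𝒜`. -/
def toPositive (ρ : CStarState 𝒜) : 𝒜 →ₚ[ℂ] ℂ :=
  PositiveLinearMap.mk₀ ρ.toLinearMap fun x hx => by
    obtain ⟨y, rfl⟩ := CStarAlgebra.nonneg_iff_eq_star_mul_self.mp hx
    exact ρ.nonneg' y

theorem toPositive_apply (ρ : CStarState 𝒜) (x : 𝒜) : ρ.toPositive x = ρ x := rfl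

/-- The cyclic vector of the GNS construction, the class of `1`. -/
def cyclicVector (ρ : CStarState 𝒜) : ρ.toPositive.GNS :=
  ((ρ.toPositive.toPreGNS 1 : ρ.toPositive.PreGNS) : ρ.toPositive.GNS)

theorem inner_cyclicVector (ρ : CStarState 𝒜) (x : 𝒜) :
    inner ℂ ρ.cyclicVector (ρ.toPositive.gnsStarAlgHom x ρ.cyclicVector) = ρ x := by
  have h : ρ.toPositive.gnsStarAlgHom x ρ.cyclicVector =
      ((ρ.toPositive.toPreGNS x : ρ.toPositive.PreGNS) : ρ.toPositive.GNS) := by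
    change ρ.toPositive.gnsNonUnitalStarAlgHom x _ = _
    rw [cyclicVector, PositiveLinearMap.gnsNonUnitalStarAlgHom_apply_coe,
      PositiveLinearMap.leftMulMapPreGNS_apply]
    simp
  rw [h, cyclicVector, UniformSpace.Completion.inner_coe, PositiveLinearMap.preGNS_inner_def]
  simp [toPositive_apply]

end GNS

/-- The GNS representation `π_ρ` of a state `ρ`. -/
def gns (ρ : CStarState 𝒜) : HilbertRep.{v} 𝒜 :=
  letI := CStarAlgebra.spectralOrder 𝒜
  letI := CStarAlgebra.spectralOrderedRing 𝒜
  { carrier := ρ.toPositive.GNS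
    toHom := ρ.toPositive.gnsStarAlgHom }

/-- The GNS vector `Ω_ρ`. -/
def gnsVector (ρ : CStarState 𝒜) : ρ.gns.carrier :=
  letI := CStarAlgebra.spectralOrder 𝒜
  letI := CStarAlgebra.spectralOrderedRing 𝒜
  ρ.cyclicVector

theorem inner_gnsVector (ρ : CStarState 𝒜) (x : 𝒜) :
    inner ℂ ρ.gnsVector (ρ.gns.toHom x ρ.gnsVector) = ρ x :=
  letI := CStarAlgebra.spectralOrder 𝒜
  letI := CStarAlgebra.spectralOrderedRing 𝒜
  ρ.inner_cyclicVector x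

theorem norm_gnsVector (ρ : CStarState 𝒜) : ‖ρ.gnsVector‖ = 1 := by
  have h := ρ.inner_gnsVector 1
  rw [map_one, one_apply_eq_self, inner_self_eq_norm_sq_to_K,
    show ρ 1 = 1 from ρ.map_one'] at h
  have h' : ‖ρ.gnsVector‖ ^ 2 = 1 := Complex.ofReal_injective (by simpa using h)
  exact (pow_eq_one_iff_of_nonneg (norm_nonneg _) two_ne_zero).mp h'

/-- The product state `ρ₁ ⊗ ρ₂` on the minimal tensor product, which is the vector state of
`Ω₁ ⊗ Ω₂` in the representation `π_ρ₁ ⊗ π_ρ₂`. -/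
def minTensor {𝒜 : Type v} [CStarAlgebra 𝒜] {ℬ : Type v} [CStarAlgebra ℬ]
    (ρ₁ : CStarState 𝒜) (ρ₂ : CStarState ℬ) : CStarState (MinTensor.{v} 𝒜 ℬ) :=
  ofVector (ρ₁.gns.minTensor ρ₂.gns)
    (HilbertRep.tmulVec ρ₁.gns ρ₂.gns ρ₁.gnsVector ρ₂.gnsVector)
    (by rw [HilbertRep.norm_tmulVec, norm_gnsVector, norm_gnsVector, one_mul])

/-- The product state is given on elementary tensors by `(ρ₁ ⊗ ρ₂) (a ⊗ b) = ρ₁ a * ρ₂ b`. -/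
theorem minTensor_tmul {𝒜 : Type v} [CStarAlgebra 𝒜] {ℬ : Type v} [CStarAlgebra ℬ]
    (ρ₁ : CStarState 𝒜) (ρ₂ : CStarState ℬ) (a : 𝒜) (b : ℬ) :
    ρ₁.minTensor ρ₂ (MinTensor.tmul a b) = ρ₁ a * ρ₂ b := by
  rw [minTensor, ofVector_apply, HilbertRep.minTensor_tmul_tmulVec, HilbertRep.inner_tmulVec,
    inner_gnsVector, inner_gnsVector]

end CStarState

/-! ### The operation `⊗_φ` -/

namespace CuntzKrieger

/-- Nondegenerate `n × n` matrices with entries in `{0, 1}`, where `2 ≤ n`: no row and no column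
is zero. -/
structure IsNondegenerate {n : ℕ} (A : Matrix (Fin n) (Fin n) ℕ) : Prop where
  two_le : 2 ≤ n
  entries : ∀ i j, A i j = 0 ∨ A i j = 1
  row_ne_zero : ∀ i, ∃ j, A i j ≠ 0
  col_ne_zero : ∀ j, ∃ i, A i j ≠ 0

variable {n m : ℕ}

/-- The Kronecker product `A ⊠ B`, with the index pair `(i, j)` identified with the index
`m * i + j` (indices are counted from zero). -/
def kron (A : Matrix (Fin n) (Fin n) ℕ) (B : Matrix (Fin m) (Fin m) ℕ) :
    Matrix (Fin (n * m)) (Fin (n * m)) ℕ :=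
  Matrix.reindex finProdFinEquiv finProdFinEquiv (Matrix.kronecker A B)

theorem kron_apply (A : Matrix (Fin n) (Fin n) ℕ) (B : Matrix (Fin m) (Fin m) ℕ)
    (k l : Fin (n * m)) :
    kron A B k l = A k.divNat l.divNat * B k.modNat l.modNat := rfl

variable (A : Matrix (Fin n) (Fin n) ℕ) (B : Matrix (Fin m) (Fin m) ℕ)

theorem sum_divNat_modNat {M : Type*} [AddCommMonoid M] (f : Fin n → Fin m → M) :
    ∑ k : Fin (n * m), f k.divNat k.modNat = ∑ i, ∑ j, f i j := by
  rw [← Fintype.sum_prod_type']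
  exact Fintype.sum_equiv finProdFinEquiv.symm _ _ fun k => rfl

theorem isCuntzKriegerFamily_tmul :
    IsCuntzKriegerFamily (kron A B) fun k =>
      (MinTensor.tmul (s A k.divNat) (s B k.modNat) :
        MinTensor.{u} (CuntzKrieger A) (CuntzKrieger B)) where
  partialIsometry k := by
    simp only [MinTensor.tmul]
    rw [← map_star, ← map_mul, ← map_mul, TensorProduct.star_tmul,
      Algebra.TensorProduct.tmul_mul_tmul, Algebra.TensorProduct.tmul_mul_tmul,
      (isCuntzKriegerFamily_s A).partialIsometry, (isCuntzKriegerFamily_s B).partialIsometry]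
  star_mul_self k := by
    simp only [MinTensor.tmul, ← map_star, ← map_mul, ← map_nsmul, ← map_sum,
      TensorProduct.star_tmul, Algebra.TensorProduct.tmul_mul_tmul, kron_apply]
    congr 1
    rw [sum_divNat_modNat fun i j => (A k.divNat i * B k.modNat j) •
        ((s A i * star (s A i)) ⊗ₜ[ℂ] (s B j * star (s B j))),
      (isCuntzKriegerFamily_s A).star_mul_self, (isCuntzKriegerFamily_s B).star_mul_self,
      TensorProduct.sum_tmul]
    refine Finset.sum_congr rfl fun i _ => ?_
    rw [TensorProduct.tmul_sum]
    refine Finset.sum_congr rfl fun j _ => ?_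
    rw [mul_smul, ← TensorProduct.tmul_smul, ← TensorProduct.smul_tmul']
  sum_eq_one := by
    simp only [MinTensor.tmul, ← map_star, ← map_mul, ← map_sum,
      TensorProduct.star_tmul, Algebra.TensorProduct.tmul_mul_tmul]
    rw [sum_divNat_modNat fun i j => (s A i * star (s A i)) ⊗ₜ[ℂ] (s B j * star (s B j))]
    simp only [← TensorProduct.tmul_sum, ← TensorProduct.sum_tmul]
    rw [(isCuntzKriegerFamily_s A).sum_eq_one, (isCuntzKriegerFamily_s B).sum_eq_one,
      ← Algebra.TensorProduct.one_def, map_one]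

/-- The ⋆-homomorphism `φ_{A,B} : 𝒪_{A ⊠ B} → 𝒪_A ⊗ 𝒪_B` into the minimal tensor product, which maps
the generator of index `m * i + j` to `s i ⊗ s j` (indices counted from zero). -/
def phi : CuntzKrieger (kron A B) →⋆ₐ[ℂ] MinTensor.{u} (CuntzKrieger A) (CuntzKrieger B) :=
  lift _ (isCuntzKriegerFamily_tmul A B)

theorem phi_s (k : Fin (n * m)) :
    phi.{u} A B (s (kron A B) k) = MinTensor.tmul (s A k.divNat) (s B k.modNat) := lift_s _ k

end CuntzKrieger

/-- The representation `π₁ ⊗_φ π₂ = (π₁ ⊗ π₂) ∘ φ_{A,B}` of `𝒪_{A ⊠ B}`. -/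
abbrev HilbertRep.phiTensor {n m : ℕ} {A : Matrix (Fin n) (Fin n) ℕ} {B : Matrix (Fin m) (Fin m) ℕ}
    (π₁ : HilbertRep.{u} (CuntzKrieger A)) (π₂ : HilbertRep.{u} (CuntzKrieger B)) :
    HilbertRep.{u} (CuntzKrieger (CuntzKrieger.kron A B)) :=
  (π₁.minTensor π₂).comp (CuntzKrieger.phi A B)

/-- The state `ρ₁ ⊗_φ ρ₂ = (ρ₁ ⊗ ρ₂) ∘ φ_{A,B}` on `𝒪_{A ⊠ B}`. -/
def CStarState.phiTensor {n m : ℕ} {A : Matrix (Fin n) (Fin n) ℕ} {B : Matrix (Fin m) (Fin m) ℕ}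
    (ρ₁ : CStarState (CuntzKrieger A)) (ρ₂ : CStarState (CuntzKrieger B)) :
    CStarState (CuntzKrieger (CuntzKrieger.kron A B)) :=
  (ρ₁.minTensor ρ₂).comp (CuntzKrieger.phi A B)

end

/-!
The positive result, that `⊗_φ` respects quasi-equivalence, rests on a description of
quasi-equivalence by intertwiners: `π₁` and `π₂` are quasi-equivalent if and only if the bounded
intertwiners from `π₁` to `π₂` separate the points of the space of `π₁`, and vice versa
(`HilbertRep.quasiEquiv_iff_intertwinersSeparate`). Tensor products of intertwiners are intertwiners of
the tensor products, and they separate points if the factors do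
(`HilbertRep.IntertwinersSeparate.minTensor_comp`), so that the description passes to `⊗_φ`.

If intertwiners separate points in both directions, then `T ξ ↦ T (x ξ)`, for intertwiners `T`, defines an
operator `y` with `y T = T x` for every `x` in the von Neumann algebra of `π₁`. It is bounded by `‖x‖`
because the products `T* T'` commute with `x`. The map `x ↦ y` is the isomorphism
(`HilbertRep.IntertwinersSeparate.quasiEquiv`). Conversely, let `f` be an isomorphism of the von Neumann
algebras and `ζ ≠ 0`. It suffices to find a vector `η` and a nonzero positive `b` below `f s`, where `s`
is the support projection of the vector functional of `ζ`, such that this functional is dominated,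
below `b`, by that of `η`: then `f y (b^{1/2} η) ↦ y (f⁻¹ b^{1/2} ζ)` is a bounded intertwiner whose
adjoint does not annihilate `ζ`. Such a `b` is the complement in `f s` of a maximal element on which the
functional of `ζ` is at least that of `η`. Maximal elements exist by Zorn's lemma, as bounded increasing
nets of positive operators converge strongly (`exists_isLUB_and_tendsto`, `exists_dominated`). In this
way the normality of `f` is not needed.

For the counterexamples to the first and the last property let `A` be the permutation matrix of the
transposition, and consider the representation of `𝒪_A` on `ℂ²` by the matrix units `E₀₁` and `E₁₀`. The
graph of `A ⊠ A` has two components, each of which yields a central projection of `𝒪_{A ⊠ A}`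
(`CuntzKrieger.commute_sum_range`). These projections decompose the tensor square of the representation,
which is therefore not a factor representation, whereas the tensor square of the vector state of `e₀`
lives on one of the components only. For the asymmetry let `S_i e_n = e_{2n + i}` on `ℓ²(ℕ)`. The pairs
`(S₀, S₁)` and `(S₁, S₀)` define representations of the Cuntz algebra `𝒪₂`. In their tensor products, the
generator of index `(0, 1)` acts as `S₀ ⊗ S₀` or as `S₁ ⊗ S₁`, depending on the order. The former has the
fixed vector `e₀ ⊗ e₀`, and the latter has none except zero, so that all intertwiners annihilate
`e₀ ⊗ e₀`.
-/

/-! ### Operators on Hilbert spaces -/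

section Operators

open Filter Topology

variable {H : Type v} [NormedAddCommGroup H] [InnerProductSpace ℂ H]
  {K : Type w} [NormedAddCommGroup K] [InnerProductSpace ℂ K]

theorem re_inner_mono {a b : H →L[ℂ] H} (h : a ≤ b) (ξ : H) :
    (inner ℂ ξ (a ξ)).re ≤ (inner ℂ ξ (b ξ)).re := by
  have := ((ContinuousLinearMap.le_def a b).mp h).re_inner_nonneg_right ξ
  simpa [inner_sub_right] using this

variable [CompleteSpace H] [CompleteSpace K]

theorem re_inner_star_mul_self (c : H →L[ℂ] H) (ξ : H) :
    (inner ℂ ξ ((star c * c) ξ)).re = ‖c ξ‖ ^ 2 := by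
  rw [mul_apply_eq_comp, ContinuousLinearMap.star_eq_adjoint,
    ContinuousLinearMap.adjoint_inner_right, inner_self_eq_norm_sq_to_K]
  norm_cast

/-- A positive operator has a self-adjoint square root which commutes with everything that the
operator commutes with. -/
theorem exists_sqrt {a : H →L[ℂ] H} (ha : 0 ≤ a) :
    ∃ c : H →L[ℂ] H, IsSelfAdjoint c ∧ c * c = a ∧
      ∀ y, Commute a y → Commute c y := by
  refine ⟨CFC.sqrt a, (CFC.sqrt_nonneg a).isSelfAdjoint, CFC.sqrt_mul_sqrt_self a ha,
    fun y hy => ?_⟩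
  exact hy.cfcₙ_nnreal _

theorem VonNeumannAlgebra.mem_of_commute {N : VonNeumannAlgebra H} {c : H →L[ℂ] H}
    (h : ∀ y ∈ N.commutant, Commute y c) : c ∈ N := by
  rw [← N.commutant_commutant, VonNeumannAlgebra.mem_commutant_iff]
  exact fun y hy => h y hy

theorem VonNeumannAlgebra.commute_of_mem {N : VonNeumannAlgebra H} {c y : H →L[ℂ] H}
    (hc : c ∈ N) (hy : y ∈ N.commutant) : Commute c y :=
  VonNeumannAlgebra.mem_commutant_iff.mp hy c hc

theorem VonNeumannAlgebra.exists_sqrt {N : VonNeumannAlgebra H} {a : H →L[ℂ] H} (ha : 0 ≤ a)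
    (haN : a ∈ N) : ∃ c ∈ N, IsSelfAdjoint c ∧ c * c = a := by
  obtain ⟨c, hc, hca, hcomm⟩ := _root_.exists_sqrt ha
  exact ⟨c, mem_of_commute fun y hy => (hcomm y (commute_of_mem haN hy)).symm, hc, hca⟩

theorem norm_apply_sq_le_of_nonneg {d : H →L[ℂ] H} (hd : 0 ≤ d) (ξ : H) :
    ‖d ξ‖ ^ 2 ≤ ‖d‖ * (inner ℂ ξ (d ξ)).re := by
  obtain ⟨c, hc, rfl, -⟩ := exists_sqrt hd
  have h1 : (inner ℂ ξ ((c * c) ξ)).re = ‖c ξ‖ ^ 2 := by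
    rw [← re_inner_star_mul_self, hc.star_eq]
  have h2 : ‖c * c‖ = ‖c‖ * ‖c‖ := by
    rw [← CStarRing.norm_star_mul_self, hc.star_eq]
  rw [h1, h2, mul_apply_eq_comp]
  calc ‖c (c ξ)‖ ^ 2 ≤ (‖c‖ * ‖c ξ‖) ^ 2 := by gcongr; exact c.le_opNorm _
    _ = _ := by ring

/-- Vigier's theorem: a bounded increasing net of positive operators has a least upper bound, to
which it converges strongly. -/
theorem exists_isLUB_and_tendsto {ι : Type*} [Preorder ι] [IsDirectedOrder ι] [Nonempty ι]
    (c : ι → H →L[ℂ] H) (hmono : Monotone c) (h0 : ∀ i, 0 ≤ c i) (r : H →L[ℂ] H)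
    (hr : ∀ i, c i ≤ r) :
    ∃ a : H →L[ℂ] H, IsLUB (Set.range c) a ∧ ∀ ξ, Tendsto (fun i => c i ξ) atTop (𝓝 (a ξ)) := by
  have hnorm : ∀ i, ‖c i‖ ≤ ‖r‖ := fun i =>
    CStarAlgebra.norm_le_norm_of_nonneg_of_le (h0 i) (hr i)
  have hcauchy : ∀ ξ, Cauchy (map (fun i => c i ξ) atTop) := by
    intro ξ
    rw [Metric.cauchy_iff]
    refine ⟨inferInstance, fun ε hε => ?_⟩
    have hbdd : BddAbove (Set.range fun i => (inner ℂ ξ (c i ξ)).re) :=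
      ⟨(inner ℂ ξ (r ξ)).re, by rintro _ ⟨i, rfl⟩; exact re_inner_mono (hr i) ξ⟩
    have hδ : 0 < (ε / 2) ^ 2 / (‖r‖ + 1) := by positivity
    obtain ⟨_, ⟨i₀, rfl⟩, hi₀⟩ := exists_lt_of_lt_csSup (Set.range_nonempty _)
      (sub_lt_self (sSup (Set.range fun i => (inner ℂ ξ (c i ξ)).re)) hδ)
    have key : ∀ j, i₀ ≤ j → dist (c j ξ) (c i₀ ξ) < ε / 2 := by
      intro j hj
      have hd0 : 0 ≤ c j - c i₀ := sub_nonneg.mpr (hmono hj)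
      have hdn : ‖c j - c i₀‖ ≤ ‖r‖ := CStarAlgebra.norm_le_norm_of_nonneg_of_le hd0
        ((sub_le_self _ (h0 i₀)).trans (hr j))
      have h1 := norm_apply_sq_le_of_nonneg hd0 ξ
      have h2 : (inner ℂ ξ ((c j - c i₀) ξ)).re ≤ (ε / 2) ^ 2 / (‖r‖ + 1) := by
        have h3 : (inner ℂ ξ (c j ξ)).re ≤ sSup (Set.range fun i => (inner ℂ ξ (c i ξ)).re) :=
          le_csSup hbdd ⟨j, rfl⟩
        simp only [sub_apply, inner_sub_right, Complex.sub_re]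
        linarith
      have h4 : ‖(c j - c i₀) ξ‖ ^ 2 < (ε / 2) ^ 2 := by
        refine h1.trans_lt ((mul_le_mul_of_nonneg_left h2 (norm_nonneg _)).trans_lt ?_)
        rw [mul_div_assoc', div_lt_iff₀ (by positivity), mul_comm]
        have : 0 < (ε / 2) ^ 2 := by positivity
        nlinarith
      rw [dist_eq_norm, ← sub_apply]
      exact lt_of_pow_lt_pow_left₀ 2 (by positivity) h4
    refine ⟨_, image_mem_map (Ici_mem_atTop i₀), ?_⟩
    rintro _ ⟨j, hj, rfl⟩ _ ⟨k, hk, rfl⟩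
    calc dist (c j ξ) (c k ξ) ≤ dist (c j ξ) (c i₀ ξ) + dist (c k ξ) (c i₀ ξ) :=
          dist_triangle_right _ _ _
      _ < ε := by linarith [key j hj, key k hk]
  have hex : ∀ ξ, ∃ l, Tendsto (fun i => c i ξ) atTop (𝓝 l) := fun ξ =>
    CompleteSpace.complete (hcauchy ξ)
  choose L hL using hex
  have hlim : Tendsto (fun i ξ => c i ξ) atTop (𝓝 L) := tendsto_pi_nhds.mpr hL
  obtain ⟨a, ha⟩ : ∃ a : H →L[ℂ] H, ∀ ξ, Tendsto (fun i => c i ξ) atTop (𝓝 (a ξ)) :=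
    ⟨(linearMapOfTendsto L (fun i => (c i : H →ₗ[ℂ] H)) hlim).mkContinuous ‖r‖ fun ξ =>
      le_of_tendsto (hL ξ).norm (Eventually.of_forall fun i =>
        ((c i).le_opNorm ξ).trans (mul_le_mul_of_nonneg_right (hnorm i) (norm_nonneg ξ))), hL⟩
  have hinner : ∀ ξ, Tendsto (fun i => (inner ℂ ξ (c i ξ)).re) atTop
      (𝓝 (inner ℂ ξ (a ξ)).re) := fun ξ =>
    (Complex.continuous_re.tendsto _).comp (tendsto_const_nhds.inner (ha ξ))
  have hsa : ∀ b : H →L[ℂ] H, 0 ≤ b → IsSelfAdjoint b := fun b hb =>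
    ((ContinuousLinearMap.nonneg_iff_isPositive _).mp hb).isSelfAdjoint
  have hasa : IsSelfAdjoint a := by
    rw [ContinuousLinearMap.isSelfAdjoint_iff_isSymmetric]
    intro x y
    refine tendsto_nhds_unique ((ha x).inner tendsto_const_nhds) ?_
    refine (tendsto_const_nhds.inner (ha y)).congr fun i => ?_
    exact (((ContinuousLinearMap.nonneg_iff_isPositive _).mp (h0 i)).inner_left_eq_inner_right
      x y).symm
  have hle : ∀ b d : H →L[ℂ] H, IsSelfAdjoint b → IsSelfAdjoint d →
      (∀ ξ, (inner ℂ ξ (b ξ)).re ≤ (inner ℂ ξ (d ξ)).re) → b ≤ d := by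
    intro b d hb hd h
    rw [ContinuousLinearMap.le_def, ContinuousLinearMap.isPositive_def']
    refine ⟨hd.sub hb, fun ξ => ?_⟩
    rw [ContinuousLinearMap.reApplyInnerSelf_apply, ← inner_re_symm]
    simpa [inner_sub_right] using h ξ
  refine ⟨a, ⟨?_, fun b hb => ?_⟩, ha⟩
  · rintro _ ⟨i, rfl⟩
    exact hle _ _ (hsa _ (h0 i)) hasa fun ξ => ge_of_tendsto (hinner ξ)
      ((eventually_ge_atTop i).mono fun j hj => re_inner_mono (hmono hj) ξ)
  · obtain ⟨i⟩ := ‹Nonempty ι›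
    exact hle _ _ hasa (hsa b ((h0 i).trans (hb ⟨i, rfl⟩))) fun ξ =>
      le_of_tendsto (hinner ξ) (Eventually.of_forall fun j => re_inner_mono (hb ⟨j, rfl⟩) ξ)

/-- A linear map which is bounded by another one, `e`, factors through a bounded operator which
vanishes on the orthogonal complement of the range of `e`. -/
theorem exists_extension {V : Type*} [AddCommGroup V] [Module ℂ V] (e : V →ₗ[ℂ] K)
    (g : V →ₗ[ℂ] H) (C : ℝ) (h : ∀ v, ‖g v‖ ≤ C * ‖e v‖) :
    ∃ S : K →L[ℂ] H, (∀ v, S (e v) = g v) ∧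
      ∀ ξ ∈ (LinearMap.range e)ᗮ, S ξ = 0 := by
  set R : Submodule ℂ K := (LinearMap.range e).topologicalClosure with hR
  have hmem : ∀ v, e v ∈ R := fun v => Submodule.le_topologicalClosure _ ⟨v, rfl⟩
  have : CompleteSpace R := (Submodule.isClosed_topologicalClosure _).completeSpace_coe
  let e' : V →ₗ[ℂ] R := e.codRestrict R hmem
  have hdense : DenseRange e' := by
    rw [DenseRange, Subtype.dense_iff]
    intro x hx
    have : (Subtype.val '' Set.range e') = (LinearMap.range e : Set K) := by
      ext y
      simp only [Set.mem_image, Set.mem_range, SetLike.mem_coe, LinearMap.mem_range]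
      constructor
      · rintro ⟨_, ⟨v, rfl⟩, rfl⟩; exact ⟨v, rfl⟩
      · rintro ⟨v, rfl⟩; exact ⟨_, ⟨v, rfl⟩, rfl⟩
    exact this ▸ hx
  refine ⟨(g.extendOfNorm e').comp R.orthogonalProjectionOnto, fun v => ?_, fun ξ hξ => ?_⟩
  · rw [ContinuousLinearMap.comp_apply]
    have h1 : R.orthogonalProjectionOnto (e v) = e' v :=
      Submodule.orthogonalProjectionOnto_mem_subspace_eq_self (e' v)
    rw [h1]
    exact LinearMap.extendOfNorm_eq hdense ⟨C, h⟩ v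
  · rw [ContinuousLinearMap.comp_apply, Submodule.orthogonalProjectionOnto_eq_zero_iff.mpr,
      map_zero]
    rwa [hR, Submodule.orthogonal_closure]

/-- Two operators which agree on a subspace and on its orthogonal complement are equal. -/
theorem clm_ext_of_orthogonal {L : Type*} [NormedAddCommGroup L] [NormedSpace ℂ L]
    (R : Submodule ℂ K) {S T : K →L[ℂ] L} (h : ∀ ξ ∈ R, S ξ = T ξ)
    (h' : ∀ ξ ∈ Rᗮ, S ξ = T ξ) : S = T := by
  have hcl : ∀ ξ ∈ R.topologicalClosure, S ξ = T ξ := fun ξ hξ =>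
    closure_minimal (s := (R : Set K)) (t := {ξ | S ξ = T ξ}) h
      (isClosed_eq S.continuous T.continuous) hξ
  have : CompleteSpace R.topologicalClosure :=
    (Submodule.isClosed_topologicalClosure _).completeSpace_coe
  ext ξ
  obtain ⟨y, hy, z, hz, rfl⟩ := R.topologicalClosure.exists_add_mem_mem_orthogonal ξ
  rw [Submodule.orthogonal_closure] at hz
  rw [map_add, map_add, hcl y hy, h' z hz]

/-- A positive functional `ψ` on a von Neumann algebra which is smaller than the vector functional
of `η` on the positive element `e` is dominated by this vector functional below some nonzero
positive `b ≤ e`: if `a` is maximal among the elements of `[0, e]` on which `ψ` is at least the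
vector functional, then `b = e - a` will do. Only the normality of vector functionals is needed for
the existence of `a`, whereas `ψ` need not be normal. -/
theorem exists_dominated (N : VonNeumannAlgebra K) (ψ : N.toStarSubalgebra → ℝ)
    (hadd : ∀ x y, ψ (x + y) = ψ x + ψ y)
    (hmono : ∀ x y : N.toStarSubalgebra, (x : K →L[ℂ] K) ≤ y → ψ x ≤ ψ y)
    (η : K) (e : N.toStarSubalgebra) (he : (0 : K →L[ℂ] K) ≤ e)
    (hlt : ψ e < (inner ℂ η ((e : K →L[ℂ] K) η)).re) :
    ∃ b : N.toStarSubalgebra, b ≠ 0 ∧ (0 : K →L[ℂ] K) ≤ b ∧ (b : K →L[ℂ] K) ≤ e ∧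
      ∀ x : N.toStarSubalgebra, (0 : K →L[ℂ] K) ≤ x → (x : K →L[ℂ] K) ≤ b →
        ψ x ≤ (inner ℂ η ((x : K →L[ℂ] K) η)).re := by
  have hz : ψ 0 = 0 := by
    have := hadd 0 0
    rw [add_zero] at this
    linarith
  let P : Set N.toStarSubalgebra := {a | (0 : K →L[ℂ] K) ≤ a ∧ (a : K →L[ℂ] K) ≤ e ∧
    (inner ℂ η ((a : K →L[ℂ] K) η)).re ≤ ψ a}
  have h0P : (0 : N.toStarSubalgebra) ∈ P := ⟨le_rfl, he, by simp [hz]⟩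
  obtain ⟨a, haP, hmax⟩ : ∃ a ∈ P, ∀ x ∈ P, (a : K →L[ℂ] K) ≤ x → x = a := by
    obtain ⟨a, ha⟩ := zorn_le₀ P (fun C hCP hC => by
      rcases C.eq_empty_or_nonempty with rfl | hne
      · exact ⟨0, h0P, by simp⟩
      have : Nonempty C := hne.to_subtype
      have : IsDirectedOrder C := hC.directedOn.isDirectedOrder
      obtain ⟨l, hlub, hl⟩ := exists_isLUB_and_tendsto (fun c : C => ((c : N.toStarSubalgebra) : K →L[ℂ] K))
        (fun c d h => h) (fun c => (hCP c.2).1) (e : K →L[ℂ] K) (fun c => (hCP c.2).2.1)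
      have hlN : l ∈ N := by
        refine VonNeumannAlgebra.mem_of_commute fun y hy => ?_
        ext ξ
        refine tendsto_nhds_unique ((y.continuous.tendsto _).comp (hl ξ)) ?_
        refine (hl (y ξ)).congr fun c => ?_
        exact congrArg (fun T : K →L[ℂ] K => T ξ)
          (VonNeumannAlgebra.commute_of_mem (N := N) c.1.2 hy).eq
      have hle : ∀ c : C, ((c : N.toStarSubalgebra) : K →L[ℂ] K) ≤ l := fun c => hlub.1 ⟨c, rfl⟩
      have hle' : l ≤ e := hlub.2 (by rintro _ ⟨c, rfl⟩; exact (hCP c.2).2.1)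
      refine ⟨⟨l, hlN⟩, ⟨?_, hle', ?_⟩, fun c hc => hle ⟨c, hc⟩⟩
      · obtain ⟨c⟩ := ‹Nonempty C›
        exact (hCP c.2).1.trans (hle c)
      · exact le_of_tendsto ((Complex.continuous_re.tendsto _).comp
          (tendsto_const_nhds.inner (hl η))) (Eventually.of_forall fun c =>
          (hCP c.2).2.2.trans (hmono _ _ (hle c))))
    exact ⟨a, ha.prop, fun x hx hax => le_antisymm (ha.2 hx hax) hax⟩
  refine ⟨e - a, ?_, ?_, ?_, fun x hx0 hxb => ?_⟩
  · intro h
    have hea : e = a := sub_eq_zero.mp h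
    exact absurd hlt (not_lt.mpr (hea ▸ haP.2.2))
  · exact sub_nonneg.mpr haP.2.1
  · exact sub_le_self _ haP.1
  · by_contra! hlt'
    have hxa : a + x ∈ P := by
      refine ⟨add_nonneg haP.1 hx0, ?_, ?_⟩
      · have : (x : K →L[ℂ] K) ≤ e - a := hxb
        calc ((a + x : N.toStarSubalgebra) : K →L[ℂ] K) = a + x := rfl
          _ ≤ a + (e - a) := by gcongr
          _ = e := by abel
      · rw [hadd]
        have : (inner ℂ η (((a + x : N.toStarSubalgebra) : K →L[ℂ] K) η)).re =
            (inner ℂ η ((a : K →L[ℂ] K) η)).re + (inner ℂ η ((x : K →L[ℂ] K) η)).re := by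
          rw [← Complex.add_re, ← inner_add_right]; rfl
        rw [this]
        exact add_le_add haP.2.2 hlt'.le
    have hx : x = 0 := by
      simpa using hmax _ hxa (le_add_of_nonneg_right hx0)
    rw [hx, hz] at hlt'
    simp at hlt'

end Operators

/-! ### Intertwiners -/

namespace HilbertRep

variable {𝒜 : Type v} [CStarAlgebra 𝒜]

/-- The bounded operator `T` intertwines the representations `π₁` and `π₂`. -/
def IsIntertwiner (π₁ π₂ : HilbertRep.{u} 𝒜) (T : π₁.carrier →L[ℂ] π₂.carrier) : Prop :=
  ∀ x ξ, T (π₁.toHom x ξ) = π₂.toHom x (T ξ)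

/-- The intertwiners from `π₁` to `π₂` separate the points of the space of `π₁`. Equivalently, no
nonzero subrepresentation of `π₁` is disjoint from `π₂`. -/
def IntertwinersSeparate (π₁ π₂ : HilbertRep.{u} 𝒜) : Prop :=
  ∀ ξ : π₁.carrier, (∀ T : π₁.carrier →L[ℂ] π₂.carrier, IsIntertwiner π₁ π₂ T → T ξ = 0) → ξ = 0

variable {π₁ π₂ π₃ : HilbertRep.{u} 𝒜}

theorem inner_toHom_left (π : HilbertRep.{u} 𝒜) (x : 𝒜) (ξ η : π.carrier) :
    inner ℂ (π.toHom x ξ) η = inner ℂ ξ (π.toHom (star x) η) := by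
  rw [map_star, ContinuousLinearMap.star_eq_adjoint, ContinuousLinearMap.adjoint_inner_right]

theorem IsIntertwiner.adjoint {T : π₁.carrier →L[ℂ] π₂.carrier} (hT : IsIntertwiner π₁ π₂ T) :
    IsIntertwiner π₂ π₁ (ContinuousLinearMap.adjoint T) := fun x ξ =>
  ext_inner_right ℂ fun v => by
    rw [ContinuousLinearMap.adjoint_inner_left, inner_toHom_left, inner_toHom_left,
      ContinuousLinearMap.adjoint_inner_left, hT]

theorem IsIntertwiner.comp {S : π₂.carrier →L[ℂ] π₃.carrier} {T : π₁.carrier →L[ℂ] π₂.carrier}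
    (hS : IsIntertwiner π₂ π₃ S) (hT : IsIntertwiner π₁ π₂ T) :
    IsIntertwiner π₁ π₃ (S.comp T) := fun x ξ => by
  rw [ContinuousLinearMap.comp_apply, hT, hS, ContinuousLinearMap.comp_apply]

theorem mem_commutant_vonNeumann {π : HilbertRep.{u} 𝒜} {y : π.carrier →L[ℂ] π.carrier} :
    y ∈ π.vonNeumann.commutant ↔ IsIntertwiner π π y := by
  have h : y ∈ π.vonNeumann.commutant ↔ y ∈ Set.centralizer (Set.range π.toHom) := by
    rw [← SetLike.mem_coe, VonNeumannAlgebra.coe_commutant, coe_vonNeumann,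
      Set.centralizer_centralizer_centralizer]
  rw [h, Set.mem_centralizer_iff]
  constructor
  · intro hy x ξ
    exact (congrArg (fun S => S ξ) (hy _ ⟨x, rfl⟩)).symm
  · rintro hy _ ⟨x, rfl⟩
    ext ξ
    exact (hy x ξ).symm

theorem apply_intertwiner_of_mem {π : HilbertRep.{u} 𝒜} {x y : π.carrier →L[ℂ] π.carrier}
    (hx : x ∈ π.vonNeumann) (hy : IsIntertwiner π π y) (ξ : π.carrier) : x (y ξ) = y (x ξ) :=
  congrArg (fun S => S ξ)
    (VonNeumannAlgebra.commute_of_mem hx (mem_commutant_vonNeumann.mpr hy)).eq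

/-- If the intertwiners from `π₂` to `π₁` separate points, then a vector which is orthogonal to the
ranges of all intertwiners from `π₁` to `π₂` is zero. -/
theorem IntertwinersSeparate.eq_zero_of_inner (h : IntertwinersSeparate π₂ π₁) {η : π₂.carrier}
    (hη : ∀ T, IsIntertwiner π₁ π₂ T → ∀ ξ, inner ℂ η (T ξ) = 0) : η = 0 := by
  refine h η fun S hS => ext_inner_right ℂ fun v => ?_
  rw [inner_zero_left, ← ContinuousLinearMap.adjoint_inner_right, hη _ hS.adjoint]

theorem IntertwinersSeparate.clm_ext {L : Type*} [NormedAddCommGroup L] [NormedSpace ℂ L]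
    (h : IntertwinersSeparate π₂ π₁) {A B : π₂.carrier →L[ℂ] L}
    (hAB : ∀ T, IsIntertwiner π₁ π₂ T → ∀ ξ, A (T ξ) = B (T ξ)) : A = B := by
  let R : Submodule ℂ π₂.carrier :=
    ⨆ T : {T : π₁.carrier →L[ℂ] π₂.carrier // IsIntertwiner π₁ π₂ T}, LinearMap.range T.1.toLinearMap
  have hR : ∀ T, IsIntertwiner π₁ π₂ T → ∀ ξ, T ξ ∈ R := fun T hT ξ =>
    Submodule.mem_iSup_of_mem (p := fun T : {T : π₁.carrier →L[ℂ] π₂.carrier //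
      IsIntertwiner π₁ π₂ T} => LinearMap.range T.1.toLinearMap) ⟨T, hT⟩ ⟨ξ, rfl⟩
  refine clm_ext_of_orthogonal R (fun ξ hξ => ?_) fun ξ hξ => ?_
  · have : R ≤ LinearMap.eqLocus A.toLinearMap B.toLinearMap := by
      refine iSup_le ?_
      rintro ⟨T, hT⟩ _ ⟨ξ, rfl⟩
      exact hAB T hT ξ
    exact this hξ
  · have hz : ξ = 0 := h.eq_zero_of_inner fun T hT v => by
      rw [← inner_conj_symm, hξ _ (hR T hT v), map_zero]
    rw [hz, map_zero, map_zero]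

/-! ### Separating intertwiners yield quasi-equivalence -/

/-- The map `ξ ↦ T (x ξ)` on each summand of the direct sum of copies of the space of `π₁`, one for
every intertwiner `T` from `π₁` to `π₂`. -/
noncomputable def rowMap (π₁ π₂ : HilbertRep.{u} 𝒜) (x : π₁.carrier →L[ℂ] π₁.carrier) :
    ({T : π₁.carrier →L[ℂ] π₂.carrier // IsIntertwiner π₁ π₂ T} →₀ π₁.carrier) →ₗ[ℂ] π₂.carrier :=
  Finsupp.lsum ℂ fun T => (T.1.comp x).toLinearMap

theorem rowMap_single (x : π₁.carrier →L[ℂ] π₁.carrier)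
    (T : {T : π₁.carrier →L[ℂ] π₂.carrier // IsIntertwiner π₁ π₂ T}) (ξ : π₁.carrier) :
    rowMap π₁ π₂ x (Finsupp.single T ξ) = T.1 (x ξ) := by
  simp [rowMap]

theorem rowMap_add (x y : π₁.carrier →L[ℂ] π₁.carrier)
    (F : {T : π₁.carrier →L[ℂ] π₂.carrier // IsIntertwiner π₁ π₂ T} →₀ π₁.carrier) :
    rowMap π₁ π₂ (x + y) F = rowMap π₁ π₂ x F + rowMap π₁ π₂ y F := by
  induction F using Finsupp.induction_linear with
  | zero => simp
  | add F G hF hG => rw [map_add, map_add, map_add, hF, hG]; abel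
  | single T ξ => simp [rowMap_single]

theorem rowMap_smul (c : ℂ) (x : π₁.carrier →L[ℂ] π₁.carrier)
    (F : {T : π₁.carrier →L[ℂ] π₂.carrier // IsIntertwiner π₁ π₂ T} →₀ π₁.carrier) :
    rowMap π₁ π₂ (c • x) F = c • rowMap π₁ π₂ x F := by
  induction F using Finsupp.induction_linear with
  | zero => simp
  | add F G hF hG => rw [map_add, map_add, hF, hG, smul_add]
  | single T ξ => simp [rowMap_single]

/-- The products `T* T'` of intertwiners lie in the commutant of `π₁`, hence commute with the
elements of the von Neumann algebra. -/
theorem inner_rowMap_rowMap {x : π₁.carrier →L[ℂ] π₁.carrier} (hx : x ∈ π₁.vonNeumann)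
    (y : π₁.carrier →L[ℂ] π₁.carrier)
    (F G : {T : π₁.carrier →L[ℂ] π₂.carrier // IsIntertwiner π₁ π₂ T} →₀ π₁.carrier) :
    inner ℂ (rowMap π₁ π₂ x F) (rowMap π₁ π₂ y G) =
      inner ℂ (rowMap π₁ π₂ 1 F) (rowMap π₁ π₂ (star x * y) G) := by
  induction F using Finsupp.induction_linear with
  | zero => simp
  | add F F' hF hF' => rw [map_add, map_add, inner_add_left, inner_add_left, hF, hF']
  | single T ξ =>
    induction G using Finsupp.induction_linear with
    | zero => simp
    | add G G' hG hG' => rw [map_add, map_add, inner_add_right, inner_add_right, hG, hG']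
    | single T' ξ' =>
      rw [rowMap_single, rowMap_single, rowMap_single, rowMap_single, one_apply_eq_self,
        mul_apply_eq_comp, ← ContinuousLinearMap.adjoint_inner_right,
        ← ContinuousLinearMap.adjoint_inner_right T.1, ← ContinuousLinearMap.adjoint_inner_right x,
        ← ContinuousLinearMap.star_eq_adjoint x]
      congr 1
      exact apply_intertwiner_of_mem (star_mem hx) (T.2.adjoint.comp T'.2) (y ξ')

theorem norm_rowMap_le {x : π₁.carrier →L[ℂ] π₁.carrier} (hx : x ∈ π₁.vonNeumann)
    (F : {T : π₁.carrier →L[ℂ] π₂.carrier // IsIntertwiner π₁ π₂ T} →₀ π₁.carrier) :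
    ‖rowMap π₁ π₂ x F‖ ≤ ‖x‖ * ‖rowMap π₁ π₂ 1 F‖ := by
  -- With `b = (‖x‖² - x* x)^{1/2}` the difference of the squares is `‖rowMap b F‖²`.
  have hpos : 0 ≤ ((‖x‖ ^ 2 : ℝ) : ℂ) • (1 : π₁.carrier →L[ℂ] π₁.carrier) - star x * x := by
    rw [sub_nonneg]
    have h := CStarAlgebra.star_mul_le_algebraMap_norm_sq (a := x)
    rw [Algebra.algebraMap_eq_smul_one] at h
    rwa [Complex.coe_smul]
  have hmem : ((‖x‖ ^ 2 : ℝ) : ℂ) • (1 : π₁.carrier →L[ℂ] π₁.carrier) - star x * x ∈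
      π₁.vonNeumann := by
    refine sub_mem ?_ (mul_mem (star_mem hx) hx)
    exact π₁.vonNeumann.toStarSubalgebra.smul_mem (one_mem _) _
  obtain ⟨b, hb, hsa, hbb⟩ := VonNeumannAlgebra.exists_sqrt hpos hmem
  have h1 := inner_rowMap_rowMap (π₂ := π₂) hx x F F
  have h2 := inner_rowMap_rowMap (π₂ := π₂) hb b F F
  have h3 : star x * x + star b * b = ((‖x‖ ^ 2 : ℝ) : ℂ) • 1 := by
    rw [hsa.star_eq, hbb]; abel
  have h4 := rowMap_add (π₂ := π₂) (star x * x) (star b * b) F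
  rw [h3, rowMap_smul] at h4
  have h5 := congrArg (fun v => inner ℂ (rowMap π₁ π₂ 1 F) v) h4
  simp only [inner_add_right, inner_smul_right] at h5
  rw [← h1, ← h2, inner_self_eq_norm_sq_to_K, inner_self_eq_norm_sq_to_K,
    inner_self_eq_norm_sq_to_K] at h5
  have h6 : ‖x‖ ^ 2 * ‖rowMap π₁ π₂ 1 F‖ ^ 2 =
      ‖rowMap π₁ π₂ x F‖ ^ 2 + ‖rowMap π₁ π₂ b F‖ ^ 2 :=
    Complex.ofReal_injective (by simpa using h5)
  refine (sq_le_sq₀ (norm_nonneg _) (by positivity)).mp ?_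
  rw [mul_pow, h6]
  exact le_add_of_nonneg_right (sq_nonneg _)

/-- Every element `x` of the von Neumann algebra of `π₁` has a counterpart `y` in that of `π₂`,
characterized by `y T = T x` for all intertwiners `T` from `π₁` to `π₂`. -/
theorem IntertwinersSeparate.exists_transfer (h : IntertwinersSeparate π₂ π₁)
    {x : π₁.carrier →L[ℂ] π₁.carrier} (hx : x ∈ π₁.vonNeumann) :
    ∃ y ∈ π₂.vonNeumann, (∀ T, IsIntertwiner π₁ π₂ T → ∀ ξ, y (T ξ) = T (x ξ)) ∧
      ∀ S, IsIntertwiner π₂ π₁ S → ∀ η, x (S η) = S (y η) := by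
  have hdense : DenseRange (rowMap π₁ π₂ 1) := by
    change Dense ((LinearMap.range (rowMap π₁ π₂ 1) : Submodule ℂ π₂.carrier) : Set π₂.carrier)
    rw [Submodule.dense_iff_topologicalClosure_eq_top, Submodule.topologicalClosure_eq_top_iff,
      Submodule.eq_bot_iff]
    intro η hη
    refine h.eq_zero_of_inner fun T hT ξ => ?_
    rw [← inner_conj_symm]
    have := hη (T ξ) ⟨Finsupp.single ⟨T, hT⟩ ξ, by rw [rowMap_single, one_apply_eq_self]⟩
    rw [this, map_zero]
  have hy : ∀ T, IsIntertwiner π₁ π₂ T → ∀ ξ,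
      ((rowMap π₁ π₂ x).extendOfNorm (rowMap π₁ π₂ 1)) (T ξ) = T (x ξ) := fun T hT ξ => by
    have := LinearMap.extendOfNorm_eq hdense ⟨‖x‖, norm_rowMap_le hx⟩ (Finsupp.single ⟨T, hT⟩ ξ)
    rwa [rowMap_single, rowMap_single, one_apply_eq_self] at this
  refine ⟨(rowMap π₁ π₂ x).extendOfNorm (rowMap π₁ π₂ 1), ?_, hy, fun S hS η => ?_⟩
  · refine VonNeumannAlgebra.mem_of_commute fun z hz => h.clm_ext fun T hT ξ => ?_
    rw [mul_apply_eq_comp, mul_apply_eq_comp, hy T hT]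
    exact (hy _ ((mem_commutant_vonNeumann.mp hz).comp hT) ξ).symm
  · refine congrArg (fun A : π₂.carrier →L[ℂ] π₁.carrier => A η)
      (h.clm_ext (A := x.comp S) (B := S.comp _) fun T hT ξ => ?_)
    rw [ContinuousLinearMap.comp_apply, ContinuousLinearMap.comp_apply, hy T hT]
    exact apply_intertwiner_of_mem hx (hS.comp hT) ξ

theorem IntertwinersSeparate.quasiEquiv (h : IntertwinersSeparate π₁ π₂)
    (h' : IntertwinersSeparate π₂ π₁) : QuasiEquiv π₁ π₂ := by
  choose F hF hFT _ using fun x : π₁.vonNeumann.toStarSubalgebra => h'.exists_transfer x.2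
  let f : π₁.vonNeumann.toStarSubalgebra →⋆ₐ[ℂ] π₂.vonNeumann.toStarSubalgebra :=
    { toFun := fun x => ⟨F x, hF x⟩
      map_one' := Subtype.ext (h'.clm_ext fun T hT ξ => hFT 1 T hT ξ)
      map_mul' := fun x y => Subtype.ext (h'.clm_ext fun T hT ξ => by
        refine (hFT (x * y) T hT ξ).trans ?_
        change T (x.1 (y.1 ξ)) = F x (F y (T ξ))
        rw [hFT y T hT, hFT x T hT])
      map_zero' := Subtype.ext (h'.clm_ext fun T hT ξ =>
        (hFT 0 T hT ξ).trans (map_zero T))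
      map_add' := fun x y => Subtype.ext (h'.clm_ext fun T hT ξ => by
        refine (hFT (x + y) T hT ξ).trans ?_
        change T (x.1 ξ + y.1 ξ) = F x (T ξ) + F y (T ξ)
        rw [hFT y T hT, hFT x T hT, map_add])
      commutes' := fun c => Subtype.ext (h'.clm_ext fun T hT ξ =>
        (hFT _ T hT ξ).trans (map_smul T c ξ))
      map_star' := fun x => Subtype.ext (h'.clm_ext fun T hT ξ => by
        refine (hFT (star x) T hT ξ).trans ?_
        change T (star x.1 ξ) = star (F x) (T ξ)
        rw [← sub_eq_zero]
        refine h'.eq_zero_of_inner fun T' hT' ξ' => ?_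
        rw [inner_sub_left, sub_eq_zero, ContinuousLinearMap.star_eq_adjoint (F x),
          ContinuousLinearMap.adjoint_inner_left, hFT x T' hT',
          ← ContinuousLinearMap.adjoint_inner_left, ← ContinuousLinearMap.adjoint_inner_left T',
          ← ContinuousLinearMap.adjoint_inner_left x.1, ← ContinuousLinearMap.star_eq_adjoint x.1]
        congr 1
        exact (apply_intertwiner_of_mem (star_mem x.2) (hT'.adjoint.comp hT) ξ).symm) }
  have hbij : Function.Bijective f := by
    constructor
    · rw [injective_iff_map_eq_zero]
      intro x hx
      refine Subtype.ext (ContinuousLinearMap.ext fun ξ => h _ fun T hT => ?_)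
      rw [← hFT x T hT ξ]
      exact congrArg (fun y : π₂.vonNeumann.toStarSubalgebra => y.1 (T ξ)) hx
    · rintro ⟨y, hy⟩
      obtain ⟨x, hx, -, hxT⟩ := h.exists_transfer hy
      exact ⟨⟨x, hx⟩, Subtype.ext (h'.clm_ext fun T hT ξ =>
        (hFT ⟨x, hx⟩ T hT ξ).trans (hxT T hT ξ).symm)⟩
  exact ⟨StarAlgEquiv.ofBijective f hbij, fun x => h'.clm_ext fun T hT ξ =>
    (hFT _ T hT ξ).trans (hT x ξ)⟩

end HilbertRep

/-! ### Quasi-equivalence yields separating intertwiners -/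

namespace HilbertRep

variable {𝒜 : Type v} [CStarAlgebra 𝒜]

theorem starAlgEquiv_mono {H : Type v} [NormedAddCommGroup H] [InnerProductSpace ℂ H]
    [CompleteSpace H] {K : Type w} [NormedAddCommGroup K] [InnerProductSpace ℂ K] [CompleteSpace K]
    {M : VonNeumannAlgebra H} {N : VonNeumannAlgebra K}
    (f : M.toStarSubalgebra ≃⋆ₐ[ℂ] N.toStarSubalgebra) {x y : M.toStarSubalgebra}
    (h : (x : H →L[ℂ] H) ≤ y) : (f x : K →L[ℂ] K) ≤ f y := by
  obtain ⟨c, hc, hsa, hcc⟩ := VonNeumannAlgebra.exists_sqrt (sub_nonneg.mpr h) (y - x).2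
  have h1 : y - x = star (⟨c, hc⟩ : M.toStarSubalgebra) * ⟨c, hc⟩ :=
    Subtype.ext (hcc.symm.trans (congrArg (fun d => d * c) hsa.star_eq.symm))
  have h2 : f y - f x = star (f ⟨c, hc⟩) * f ⟨c, hc⟩ := by
    rw [← map_sub, h1, map_mul, map_star]
  rw [← sub_nonneg]
  refine (star_mul_self_nonneg (f ⟨c, hc⟩ : K →L[ℂ] K)).trans_eq ?_
  exact congrArg Subtype.val h2.symm

theorem star_mul_self_le_of_norm_le_one {K : Type w} [NormedAddCommGroup K]
    [InnerProductSpace ℂ K] [CompleteSpace K] {y c : K →L[ℂ] K} (hc : IsSelfAdjoint c)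
    (hy : ‖y‖ ≤ 1) : star (y * c) * (y * c) ≤ c * c := by
  have h1 := CStarAlgebra.star_left_conjugate_le_norm_smul (a := c) (b := star y * y)
    (IsSelfAdjoint.star_mul_self _)
  have h0 : 0 ≤ star c * c := star_mul_self_nonneg c
  rw [CStarRing.norm_star_mul_self] at h1
  have h2 : star (y * c) * (y * c) = star c * (star y * y) * c := by
    rw [star_mul]; noncomm_ring
  rw [h2]
  have h3 : ‖y‖ * ‖y‖ ≤ 1 := mul_le_one₀ hy (norm_nonneg _) hy
  refine h1.trans ((smul_le_smul_of_nonneg_right h3 h0).trans_eq ?_)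
  rw [one_smul, hc.star_eq]

/-- The projection onto the closed subspace which the commutant of `M` generates from `ζ`. It is the
support projection of the vector functional of `ζ` on `M`. -/
theorem exists_support {H : Type v} [NormedAddCommGroup H] [InnerProductSpace ℂ H]
    [CompleteSpace H] (M : VonNeumannAlgebra H) (ζ : H) :
    ∃ s ∈ M, IsSelfAdjoint s ∧ s * s = s ∧ s ζ = ζ ∧
      ∀ b ∈ M, 0 ≤ b → b ≤ s → b ζ = 0 → b = 0 := by
  let e : M.commutant.toStarSubalgebra →ₗ[ℂ] H :=
    { toFun := fun y => (y : H →L[ℂ] H) ζ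
      map_add' := fun _ _ => rfl
      map_smul' := fun _ _ => rfl }
  set R := LinearMap.range e with hR
  have : CompleteSpace R.topologicalClosure :=
    (Submodule.isClosed_topologicalClosure _).completeSpace_coe
  set s := R.topologicalClosure.starProjection with hs
  have hsR : ∀ v ∈ R, s v = v := fun v hv =>
    Submodule.starProjection_eq_self_iff.mpr (Submodule.le_topologicalClosure _ hv)
  have hsR' : ∀ v ∈ Rᗮ, s v = 0 := fun v hv => by
    refine (Submodule.starProjection_apply_eq_zero_iff _).mpr ?_
    rwa [Submodule.orthogonal_closure]
  have hinv : ∀ y ∈ M.commutant, ∀ v ∈ R, y v ∈ R := by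
    rintro y hy _ ⟨z, rfl⟩
    exact ⟨⟨y, hy⟩ * z, rfl⟩
  refine ⟨s, VonNeumannAlgebra.mem_of_commute fun y hy => ?_,
    isStarProjection_starProjection.isSelfAdjoint,
    isStarProjection_starProjection.isIdempotentElem, hsR ζ ⟨1, rfl⟩, fun b hb hb0 hbs hbζ => ?_⟩
  · refine clm_ext_of_orthogonal R (fun v hv => ?_) fun v hv => ?_
    · rw [mul_apply_eq_comp, mul_apply_eq_comp, hsR v hv, hsR _ (hinv y hy v hv)]
    · rw [mul_apply_eq_comp, mul_apply_eq_comp, hsR' v hv, map_zero, hsR']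
      intro w hw
      rw [← ContinuousLinearMap.adjoint_inner_left, ← ContinuousLinearMap.star_eq_adjoint]
      exact hv _ (hinv _ (star_mem hy) w hw)
  · obtain ⟨c, hc, hcc, -⟩ := exists_sqrt hb0
    refine clm_ext_of_orthogonal R ?_ fun v hv => ?_
    · rintro _ ⟨y, rfl⟩
      have := congrArg (fun T : H →L[ℂ] H => T ζ) (VonNeumannAlgebra.commute_of_mem hb y.2).eq
      simp only [mul_apply_eq_comp, hbζ, map_zero] at this
      exact this
    · have h1 := re_inner_mono hbs v
      rw [hsR' v hv, inner_zero_right, ← hcc] at h1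
      have h2 := re_inner_star_mul_self c v
      rw [hc.star_eq] at h2
      have h3 : c v = 0 := by
        rw [← norm_eq_zero, ← sq_eq_zero_iff]
        exact le_antisymm (h2 ▸ h1) (sq_nonneg _)
      rw [← hcc, mul_apply_eq_comp, h3, map_zero, zero_apply]

/-- Let `f` be an isomorphism of von Neumann algebras, and `s` the support projection of the vector
functional of `ζ`. For a multiple `η` of a vector which is not annihilated by `f s`, the vector
functional of `ζ` is dominated by that of `η` below some nonzero `b ≤ f s`. The element `c` is the
square root of `b`. -/
theorem exists_norm_le_of_starAlgEquiv {H : Type v} [NormedAddCommGroup H] [InnerProductSpace ℂ H]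
    [CompleteSpace H] {K : Type w} [NormedAddCommGroup K] [InnerProductSpace ℂ K] [CompleteSpace K]
    {M : VonNeumannAlgebra H} {N : VonNeumannAlgebra K}
    (f : M.toStarSubalgebra ≃⋆ₐ[ℂ] N.toStarSubalgebra) {ζ : H} (hζ0 : ζ ≠ 0) :
    ∃ (η : K) (c : N.toStarSubalgebra), star c = c ∧ (f.symm c).1 ζ ≠ 0 ∧
      ∀ y : M.toStarSubalgebra, ‖y.1 ((f.symm c).1 ζ)‖ ≤ ‖(f y).1 (c.1 η)‖ := by
  obtain ⟨s, hsM, hsa, hss, hsζ, hsupp⟩ := exists_support M ζ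
  let s' : M.toStarSubalgebra := ⟨s, hsM⟩
  have hs'sa : star (f s') = f s' := by
    rw [← map_star]; exact congrArg f (Subtype.ext hsa.star_eq)
  have hs'ss : f s' * f s' = f s' := by
    rw [← map_mul]; exact congrArg f (Subtype.ext hss)
  have hs'0 : f s' ≠ 0 := by
    rw [Ne, EmbeddingLike.map_eq_zero_iff]
    intro h0
    exact hζ0 (hsζ.symm.trans (congrArg (fun x : M.toStarSubalgebra => x.1 ζ) h0))
  obtain ⟨η₀, hη₀⟩ : ∃ η₀, (f s').1 η₀ ≠ 0 := by
    by_contra! hall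
    exact hs'0 (Subtype.ext (ContinuousLinearMap.ext hall))
  have hinner : ∀ η, (inner ℂ η ((f s').1 η)).re = ‖(f s').1 η‖ ^ 2 := fun η => by
    rw [← re_inner_star_mul_self]
    have : (f s').1 = star (f s').1 * (f s').1 := by
      exact congrArg Subtype.val (hs'ss.symm.trans (congrArg (fun x => x * f s') hs'sa.symm))
    exact congrArg (fun T : K →L[ℂ] K => (inner ℂ η (T η)).re) this
  have hs'pos : (0 : K →L[ℂ] K) ≤ f s' := by
    have : f s' = star (f s') * f s' := by rw [hs'sa, hs'ss]
    exact (congrArg Subtype.val this).symm ▸ star_mul_self_nonneg (f s').1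
  obtain ⟨η, hη⟩ : ∃ η, ‖ζ‖ ^ 2 < (inner ℂ η ((f s').1 η)).re := by
    refine ⟨((‖ζ‖ + 1) / ‖(f s').1 η₀‖ : ℂ) • η₀, ?_⟩
    rw [hinner, map_smul, norm_smul]
    have h1 : ‖((‖ζ‖ + 1) / ‖(f s').1 η₀‖ : ℂ)‖ * ‖(f s').1 η₀‖ = ‖ζ‖ + 1 := by
      rw [norm_div, Complex.norm_real, norm_norm, div_mul_cancel₀ _ (norm_ne_zero_iff.mpr hη₀)]
      rw [← Complex.ofReal_one, ← Complex.ofReal_add, Complex.norm_real, Real.norm_of_nonneg]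
      positivity
    rw [h1]
    gcongr
    linarith
  obtain ⟨b, hb0, hbpos, hbs, hdom⟩ := exists_dominated N
    (fun x => (inner ℂ ζ ((f.symm x).1 ζ)).re)
    (fun x y => by
      rw [map_add, ← Complex.add_re, ← inner_add_right]; rfl)
    (fun x y hxy => re_inner_mono (starAlgEquiv_mono f.symm hxy) ζ) η (f s') hs'pos (by
      rw [f.symm_apply_apply]
      change (inner ℂ ζ (s ζ)).re < _
      rw [hsζ, inner_self_eq_norm_sq_to_K]
      refine lt_of_eq_of_lt ?_ hη
      norm_cast)
  obtain ⟨c, hcN, hcsa, hcc⟩ := VonNeumannAlgebra.exists_sqrt hbpos b.2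
  let c' : N.toStarSubalgebra := ⟨c, hcN⟩
  have hc'sa : star c' = c' := Subtype.ext hcsa.star_eq
  have hc'c' : c' * c' = b := Subtype.ext hcc
  have hbound1 : ∀ y, ‖(f y).1‖ ≤ 1 → ‖y.1 ((f.symm c').1 ζ)‖ ≤ ‖(f y).1 (c η)‖ := by
    intro y hy
    have hle : star ((f y).1 * c) * ((f y).1 * c) ≤ b :=
      (star_mul_self_le_of_norm_le_one hcsa hy).trans_eq hcc
    have hpos : 0 ≤ star ((f y).1 * c) * ((f y).1 * c) := star_mul_self_nonneg ((f y).1 * c)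
    have h1 := hdom (star (f y * c') * (f y * c')) hpos hle
    have h2 : f.symm (star (f y * c') * (f y * c')) =
        star (y * f.symm c') * (y * f.symm c') := by
      rw [map_mul, map_star, map_mul, f.symm_apply_apply]
    rw [h2] at h1
    have h3 := re_inner_star_mul_self (y * f.symm c' : M.toStarSubalgebra).1 ζ
    have h4 := re_inner_star_mul_self (f y * c' : N.toStarSubalgebra).1 η
    refine (sq_le_sq₀ (norm_nonneg _) (norm_nonneg _)).mp ?_
    exact (h3.symm.le.trans h1).trans h4.le
  have hbound : ∀ y, ‖y.1 ((f.symm c').1 ζ)‖ ≤ ‖(f y).1 (c η)‖ := by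
    intro y
    have hr : (0 : ℝ) < ‖(f y).1‖ + 1 := by positivity
    have hnr : ‖((‖(f y).1‖ + 1 : ℝ) : ℂ)⁻¹‖ = (‖(f y).1‖ + 1)⁻¹ := by
      rw [norm_inv, Complex.norm_real, Real.norm_of_nonneg hr.le]
    have h1 := hbound1 (((‖(f y).1‖ + 1 : ℝ) : ℂ)⁻¹ • y) (by
      rw [map_smul]
      change ‖_ • (f y).1‖ ≤ 1
      rw [norm_smul, hnr, inv_mul_le_iff₀ hr, mul_one]
      linarith)
    rw [map_smul] at h1
    change ‖(_ : ℂ) • y.1 ((f.symm c').1 ζ)‖ ≤ ‖(_ : ℂ) • (f y).1 (c η)‖ at h1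
    rw [norm_smul, norm_smul, hnr] at h1
    exact le_of_mul_le_mul_left h1 (inv_pos.mpr hr)
  have hdsa : star (f.symm c') = f.symm c' := by rw [← map_star, hc'sa]
  refine ⟨η, c', hc'sa, fun h2 => ?_, hbound⟩
  have hbsymm : f.symm b = f.symm c' * f.symm c' := by rw [← map_mul, hc'c']
  refine hb0 ((EmbeddingLike.map_eq_zero_iff (f := f.symm)).mp (Subtype.ext ?_))
  refine hsupp _ (f.symm b).2 ?_ ?_ ?_
  · have : f.symm b = star (f.symm c') * f.symm c' := by rw [hdsa, hbsymm]
    exact (congrArg Subtype.val this).symm ▸ star_mul_self_nonneg (f.symm c').1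
  · have := starAlgEquiv_mono f.symm hbs
    rwa [f.symm_apply_apply] at this
  · rw [hbsymm]
    change (f.symm c').1 ((f.symm c').1 ζ) = 0
    rw [h2, map_zero]


variable {π₁ π₂ : HilbertRep.{u} 𝒜}

theorem QuasiEquiv.symm (h : QuasiEquiv π₁ π₂) : QuasiEquiv π₂ π₁ := by
  obtain ⟨f, hf⟩ := h
  refine ⟨f.symm, fun x => ?_⟩
  have : f.symm ⟨π₂.toHom x, π₂.mem_vonNeumann x⟩ = ⟨π₁.toHom x, π₁.mem_vonNeumann x⟩ := by
    rw [← f.symm_apply_apply ⟨π₁.toHom x, _⟩]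
    exact congrArg f.symm (Subtype.ext (hf x).symm)
  rw [this]

/-- If the isomorphism `f` of the von Neumann algebras dominates vectors as in
`exists_norm_le_of_starAlgEquiv`, then `f y (c η) ↦ y (f⁻¹ c ζ)` is a bounded intertwiner, and its
adjoint does not annihilate `ζ`. -/
theorem QuasiEquiv.intertwinersSeparate (h : QuasiEquiv π₁ π₂) : IntertwinersSeparate π₁ π₂ := by
  obtain ⟨f, hf⟩ := h
  intro ζ hζ
  by_contra hζ0
  obtain ⟨η, c', hc'sa, hc'ζ, hbound⟩ := exists_norm_le_of_starAlgEquiv f hζ0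
  let e : π₁.vonNeumann.toStarSubalgebra →ₗ[ℂ] π₂.carrier :=
    { toFun := fun y => (f y).1 (c'.1 η)
      map_add' := fun y z => by rw [map_add]; rfl
      map_smul' := fun r y => by rw [map_smul]; rfl }
  let g : π₁.vonNeumann.toStarSubalgebra →ₗ[ℂ] π₁.carrier :=
    { toFun := fun y => y.1 ((f.symm c').1 ζ)
      map_add' := fun y z => rfl
      map_smul' := fun r y => rfl }
  obtain ⟨S, hSe, hS0⟩ := exists_extension e g 1 fun v => (one_mul ‖e v‖).symm ▸ hbound v
  have hπe : ∀ x y, π₂.toHom x (e y) = e (⟨π₁.toHom x, π₁.mem_vonNeumann x⟩ * y) := fun x y => by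
    change _ = (f _).1 (c'.1 η)
    rw [map_mul, ← hf x]
    rfl
  have hS : IsIntertwiner π₂ π₁ S := fun x ξ => by
    refine congrArg (fun A : π₂.carrier →L[ℂ] π₁.carrier => A ξ)
      (clm_ext_of_orthogonal (LinearMap.range e) (S := S.comp (π₂.toHom x))
        (T := (π₁.toHom x).comp S) ?_ fun v hv => ?_)
    · rintro _ ⟨y, rfl⟩
      rw [ContinuousLinearMap.comp_apply, ContinuousLinearMap.comp_apply, hπe, hSe, hSe]
      rfl
    · rw [ContinuousLinearMap.comp_apply, ContinuousLinearMap.comp_apply, hS0 v hv, map_zero]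
      refine hS0 _ ?_
      rintro _ ⟨y, rfl⟩
      rw [← star_star x, ← inner_toHom_left, hπe]
      exact hv _ ⟨_, rfl⟩
  have h1 : inner ℂ ζ (S (e (f.symm c'))) = 0 := by
    rw [← ContinuousLinearMap.adjoint_inner_left, hζ _ hS.adjoint, inner_zero_left]
  refine hc'ζ ?_
  have hdsa : star (f.symm c') = f.symm c' := by rw [← map_star, hc'sa]
  have h3 := re_inner_star_mul_self (f.symm c').1 ζ
  rw [hSe] at h1
  have h4 : star (f.symm c').1 = (f.symm c').1 := congrArg Subtype.val hdsa
  rw [h4, mul_apply_eq_comp] at h3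
  rw [← norm_eq_zero, ← sq_eq_zero_iff, ← h3]
  exact congrArg Complex.re h1

theorem quasiEquiv_iff_intertwinersSeparate :
    QuasiEquiv π₁ π₂ ↔ IntertwinersSeparate π₁ π₂ ∧ IntertwinersSeparate π₂ π₁ :=
  ⟨fun h => ⟨h.intertwinersSeparate, h.symm.intertwinersSeparate⟩, fun h => h.1.quasiEquiv h.2⟩

end HilbertRep

/-! ### Intertwiners of tensor products -/

section TensorMap

variable {H H' : Type v} {K K' : Type w}
  [NormedAddCommGroup H] [InnerProductSpace ℂ H] [NormedAddCommGroup H'] [InnerProductSpace ℂ H']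
  [NormedAddCommGroup K] [InnerProductSpace ℂ K] [NormedAddCommGroup K'] [InnerProductSpace ℂ K']

/-- The operator `S ⊗ T` between different Hilbert space tensor products. -/
noncomputable def tensorMap (S : H →L[ℂ] H') (T : K →L[ℂ] K') :
    HilbertTensor H K →L[ℂ] HilbertTensor H' K' :=
  (TensorProduct.mapL S T).completion

theorem tensorMap_incl (S : H →L[ℂ] H') (T : K →L[ℂ] K') (x : H ⊗[ℂ] K) :
    tensorMap S T (HilbertTensor.incl x) = HilbertTensor.incl (TensorProduct.mapL S T x) :=
  ContinuousLinearMap.completion_apply_coe _ _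

theorem inner_tensorMap_tmul [CompleteSpace H] [CompleteSpace K] [CompleteSpace H']
    [CompleteSpace K'] (S : H →L[ℂ] H') (T : K →L[ℂ] K') (ω : HilbertTensor H K) (x : H') (y : K') :
    inner ℂ (tensorMap S T ω) (HilbertTensor.incl (x ⊗ₜ[ℂ] y)) =
      inner ℂ ω (HilbertTensor.incl
        (ContinuousLinearMap.adjoint S x ⊗ₜ[ℂ] ContinuousLinearMap.adjoint T y)) := by
  refine HilbertTensor.denseRange_incl.induction_on
    (p := fun ω => inner ℂ (tensorMap S T ω) (HilbertTensor.incl (x ⊗ₜ[ℂ] y)) =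
      inner ℂ ω (HilbertTensor.incl
        (ContinuousLinearMap.adjoint S x ⊗ₜ[ℂ] ContinuousLinearMap.adjoint T y))) ω
    (by apply isClosed_eq <;> fun_prop) fun z => ?_
  rw [tensorMap_incl, LinearIsometry.inner_map_map, LinearIsometry.inner_map_map]
  induction z with
  | zero => simp
  | add z z' hz hz' => rw [map_add, inner_add_left, inner_add_left, hz, hz']
  | tmul a b =>
    rw [TensorProduct.mapL_tmul, TensorProduct.inner_tmul, TensorProduct.inner_tmul,
      ContinuousLinearMap.adjoint_inner_right, ContinuousLinearMap.adjoint_inner_right]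

theorem HilbertTensor.eq_zero_of_inner_tmul {ω : HilbertTensor H K}
    (h : ∀ x y, inner ℂ ω (incl (x ⊗ₜ[ℂ] y)) = 0) : ω = 0 := by
  refine ext_inner_right ℂ fun v => ?_
  rw [inner_zero_left]
  refine denseRange_incl.induction_on (p := fun v => inner ℂ ω v = 0) v
    (isClosed_eq (by fun_prop) continuous_const) fun z => ?_
  induction z with
  | zero => rw [map_zero, inner_zero_right]
  | add z z' hz hz' => rw [map_add, inner_add_right, hz, hz', add_zero]
  | tmul x y => exact h x y

theorem HilbertTensor.exists_clm_inner_tmul (ω : HilbertTensor H K) :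
    ∃ B : H →L[ℂ] K →L[ℂ] ℂ, ∀ x y, B x y = inner ℂ ω (incl (x ⊗ₜ[ℂ] y)) := by
  let L : H →ₗ[ℂ] K →ₗ[ℂ] ℂ := (TensorProduct.mk ℂ H K).compr₂
    ((innerSL ℂ ω).toLinearMap ∘ₗ (incl (H := H) (K := K)).toLinearMap)
  have hL : ∀ x y, L x y = inner ℂ ω (incl (x ⊗ₜ[ℂ] y)) := fun _ _ => rfl
  refine ⟨L.mkContinuous₂ ‖ω‖ fun x y => ?_, fun x y => ?_⟩
  · rw [hL]
    refine (norm_inner_le_norm ω (incl (x ⊗ₜ[ℂ] y))).trans_eq ?_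
    rw [norm_incl_tmul, mul_assoc]
  · rw [LinearMap.mkContinuous₂_apply, hL]

end TensorMap

namespace HilbertRep

variable {𝒜 : Type v} [CStarAlgebra 𝒜] {ℬ : Type v} [CStarAlgebra ℬ]

theorem continuous_toHom (π : HilbertRep.{u} 𝒜) : Continuous π.toHom :=
  AddMonoidHomClass.continuous_of_bound π.toHom 1
    fun x => by rw [one_mul]; exact MinTensor.norm_toHom_le π x

theorem IsIntertwiner.minTensor {π₁ π₁' : HilbertRep.{u} 𝒜} {π₂ π₂' : HilbertRep.{u} ℬ}
    {S : π₁.carrier →L[ℂ] π₁'.carrier} {T : π₂.carrier →L[ℂ] π₂'.carrier}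
    (hS : IsIntertwiner π₁ π₁' S) (hT : IsIntertwiner π₂ π₂' T) :
    IsIntertwiner (π₁.minTensor π₂) (π₁'.minTensor π₂') (tensorMap S T) := by
  have key : ∀ x : MinTensor.{u} 𝒜 ℬ, (tensorMap S T).comp ((π₁.minTensor π₂).toHom x) =
      ((π₁'.minTensor π₂').toHom x).comp (tensorMap S T) := by
    intro x
    refine (MinTensor.seminorm.{u} 𝒜 ℬ).denseRange_toCompletion.induction_on
      (p := fun x : MinTensor.{u} 𝒜 ℬ => (tensorMap S T).comp ((π₁.minTensor π₂).toHom x) =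
        ((π₁'.minTensor π₂').toHom x).comp (tensorMap S T)) x
      (isClosed_eq (continuous_const.clm_comp (continuous_toHom _))
        ((continuous_toHom _).clm_comp continuous_const)) fun a => ?_
    change (tensorMap S T).comp ((π₁.minTensor π₂).toHom (MinTensor.ofAlg a)) =
      ((π₁'.minTensor π₂').toHom (MinTensor.ofAlg a)).comp (tensorMap S T)
    induction a with
    | zero =>
      rw [map_zero, map_zero, map_zero, ContinuousLinearMap.comp_zero,
        ContinuousLinearMap.zero_comp]
    | add a b ha hb =>
      rw [map_add, map_add, map_add, ContinuousLinearMap.comp_add, ContinuousLinearMap.add_comp,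
        ha, hb]
    | tmul a b =>
      have h1 := minTensor_tmul π₁ π₂ a b
      have h2 := minTensor_tmul π₁' π₂' a b
      rw [MinTensor.tmul] at h1 h2
      rw [h1, h2]
      refine DFunLike.coe_injective (HilbertTensor.denseRange_incl.equalizer
        (ContinuousLinearMap.continuous _) (ContinuousLinearMap.continuous _) (funext fun z => ?_))
      simp only [Function.comp_apply, ContinuousLinearMap.comp_apply]
      rw [tensorOp_incl, tensorMap_incl, tensorMap_incl, tensorOp_incl]
      congr 1
      induction z with
      | zero => simp only [map_zero]
      | add z z' hz hz' => simp only [map_add, hz, hz']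
      | tmul ξ η =>
        rw [TensorProduct.mapL_tmul, TensorProduct.mapL_tmul, TensorProduct.mapL_tmul,
          TensorProduct.mapL_tmul, hS, hT]
  exact fun x ξ => congrArg (fun A => A ξ) (key x)

/-- If the intertwiners separate points, then the ranges of their adjoints span a dense subspace, and
elementary tensors of such vectors span a dense subspace of the tensor product. -/
theorem IntertwinersSeparate.minTensor_comp {π₁ π₁' : HilbertRep.{u} 𝒜} {π₂ π₂' : HilbertRep.{u} ℬ}
    {𝒞 : Type w} [CStarAlgebra 𝒞] (h₁ : IntertwinersSeparate π₁ π₁')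
    (h₂ : IntertwinersSeparate π₂ π₂') (f : 𝒞 →⋆ₐ[ℂ] MinTensor.{u} 𝒜 ℬ) :
    IntertwinersSeparate ((π₁.minTensor π₂).comp f) ((π₁'.minTensor π₂').comp f) := by
  intro ω hω
  have h0 : ∀ S, IsIntertwiner π₁' π₁ S → ∀ T, IsIntertwiner π₂' π₂ T → ∀ x y,
      inner ℂ ω (HilbertTensor.incl (S x ⊗ₜ[ℂ] T y)) = 0 := by
    intro S hS T hT x y
    have h := inner_tensorMap_tmul (ContinuousLinearMap.adjoint S) (ContinuousLinearMap.adjoint T)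
      ω x y
    rw [ContinuousLinearMap.adjoint_adjoint, ContinuousLinearMap.adjoint_adjoint] at h
    rw [← h, hω _ fun x ξ => (hS.adjoint.minTensor hT.adjoint) (f x) ξ, inner_zero_left]
  obtain ⟨B, hB⟩ := HilbertTensor.exists_clm_inner_tmul ω
  have hB0 : B = 0 := h₁.clm_ext fun S hS x => h₂.clm_ext fun T hT y =>
    (hB _ _).trans (h0 S hS T hT x y)
  refine HilbertTensor.eq_zero_of_inner_tmul fun x y => ?_
  rw [← hB, hB0]
  rfl

theorem QuasiEquiv.minTensor_comp {π₁ π₁' : HilbertRep.{u} 𝒜} {π₂ π₂' : HilbertRep.{u} ℬ}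
    {𝒞 : Type w} [CStarAlgebra 𝒞] (h₁ : QuasiEquiv π₁ π₁') (h₂ : QuasiEquiv π₂ π₂')
    (f : 𝒞 →⋆ₐ[ℂ] MinTensor.{u} 𝒜 ℬ) :
    QuasiEquiv ((π₁.minTensor π₂).comp f) ((π₁'.minTensor π₂').comp f) := by
  rw [quasiEquiv_iff_intertwinersSeparate] at h₁ h₂ ⊢
  exact ⟨h₁.1.minTensor_comp h₂.1 f, h₁.2.minTensor_comp h₂.2 f⟩

end HilbertRep

/-! ### Representations from Cuntz-Krieger families -/

namespace CuntzKrieger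

variable {n m : ℕ} {A : Matrix (Fin n) (Fin n) ℕ} {B : Matrix (Fin m) (Fin m) ℕ}

/-- The representation of `𝒪_A` which is given by a Cuntz-Krieger family of operators. -/
noncomputable def rep (H : Type u) [NormedAddCommGroup H] [InnerProductSpace ℂ H] [CompleteSpace H]
    {t : Fin n → H →L[ℂ] H} (ht : IsCuntzKriegerFamily A t) : HilbertRep.{u} (CuntzKrieger A) where
  carrier := H
  toHom := lift t ht

theorem rep_s (H : Type u) [NormedAddCommGroup H] [InnerProductSpace ℂ H] [CompleteSpace H]
    {t : Fin n → H →L[ℂ] H} (ht : IsCuntzKriegerFamily A t) (i : Fin n) :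
    (rep H ht).toHom (s A i) = t i := lift_s ht i

theorem phiTensor_s (π₁ : HilbertRep.{u} (CuntzKrieger A)) (π₂ : HilbertRep.{u} (CuntzKrieger B))
    (k : Fin (n * m)) : (π₁.phiTensor π₂).toHom (s (kron A B) k) =
      tensorOp (π₁.toHom (s A k.divNat)) (π₂.toHom (s B k.modNat)) := by
  rw [← HilbertRep.minTensor_tmul, ← phi_s]
  rfl

theorem phiTensor_range (π₁ : HilbertRep.{u} (CuntzKrieger A))
    (π₂ : HilbertRep.{u} (CuntzKrieger B)) (k : Fin (n * m)) :
    (π₁.phiTensor π₂).toHom (s (kron A B) k * star (s (kron A B) k)) =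
      tensorOp (π₁.toHom (s A k.divNat * star (s A k.divNat)))
        (π₂.toHom (s B k.modNat * star (s B k.modNat))) := by
  rw [map_mul, map_star, phiTensor_s, ← tensorOp_star, ← tensorOp_mul, map_mul, map_star, map_mul,
    map_star]

end CuntzKrieger

/-! ### The Cuntz algebra `𝒪₂` -/

section Shift

variable {H : Type u} [NormedAddCommGroup H] [InnerProductSpace ℂ H]
  {ι : Type v} (b : HilbertBasis ι ℂ H)

theorem HilbertBasis.clm_ext {L : Type*} [NormedAddCommGroup L] [NormedSpace ℂ L]
    {S T : H →L[ℂ] L} (h : ∀ i, S (b i) = T (b i)) : S = T :=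
  ContinuousLinearMap.ext_on
    (Submodule.dense_iff_topologicalClosure_eq_top.mpr b.dense_span) (by
      rintro _ ⟨i, rfl⟩; exact h i)

/-- The isometry which maps the basis vector `b i` to `b (f i)`. -/
noncomputable def HilbertBasis.shift [CompleteSpace H] {f : ι → ι} (hf : Function.Injective f) :
    H →ₗᵢ[ℂ] H :=
  ((b.orthonormal.comp f hf).orthogonalFamily.linearIsometry).comp b.repr.toLinearIsometry

variable [CompleteSpace H] {f : ι → ι} (hf : Function.Injective f)

theorem HilbertBasis.shift_apply (i : ι) : b.shift hf (b i) = b (f i) := by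
  classical
  have h : b.shift hf (b i) =
    (b.orthonormal.comp f hf).orthogonalFamily.linearIsometry (b.repr (b i)) := rfl
  rw [h, b.repr_self, OrthogonalFamily.linearIsometry_apply_single]
  simp

theorem HilbertBasis.adjoint_shift_apply_of_mem (i : ι) :
    ContinuousLinearMap.adjoint (b.shift hf).toContinuousLinearMap (b (f i)) = b i := by
  refine ext_inner_right ℂ fun v => ?_
  rw [ContinuousLinearMap.adjoint_inner_left, ← b.shift_apply hf]
  exact (b.shift hf).inner_map_map _ _

theorem HilbertBasis.adjoint_shift_apply_of_forall_ne {j : ι} (hj : ∀ i, f i ≠ j) :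
    ContinuousLinearMap.adjoint (b.shift hf).toContinuousLinearMap (b j) = 0 := by
  refine ext_inner_left ℂ fun v => ?_
  rw [ContinuousLinearMap.adjoint_inner_right, inner_zero_right]
  have h : (innerSL ℂ (b j)).comp (b.shift hf).toContinuousLinearMap = 0 := b.clm_ext fun i => by
    change inner ℂ (b j) (b.shift hf (b i)) = 0
    rw [b.shift_apply]
    exact b.orthonormal.2 (hj i).symm
  rw [← inner_conj_symm, show inner ℂ (b j) ((b.shift hf).toContinuousLinearMap v) = 0 from
    congrArg (fun T : H →L[ℂ] ℂ => T v) h, map_zero]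

end Shift

section Cuntz

variable {H : Type u} [NormedAddCommGroup H] [InnerProductSpace ℂ H] [CompleteSpace H]
  (b : HilbertBasis ℕ ℂ H)

theorem two_mul_add_injective (i : ℕ) : Function.Injective fun n : ℕ => 2 * n + i :=
  fun m n h => by simp only at h; omega

/-- The isometry which maps the basis vector `b n` to `b (2 * n + i)`. The isometries for `i = 0` and
`i = 1` generate a representation of the Cuntz algebra `𝒪₂`. -/
noncomputable def HilbertBasis.cuntz (i : ℕ) : H →L[ℂ] H :=
  (b.shift (two_mul_add_injective i)).toContinuousLinearMap

theorem HilbertBasis.cuntz_apply (i n : ℕ) : b.cuntz i (b n) = b (2 * n + i) :=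
  b.shift_apply (two_mul_add_injective i) n

theorem HilbertBasis.adjoint_cuntz_apply (i n : ℕ) :
    ContinuousLinearMap.adjoint (b.cuntz i) (b (2 * n + i)) = b n :=
  b.adjoint_shift_apply_of_mem (two_mul_add_injective i) n

theorem HilbertBasis.adjoint_cuntz_apply_of_mod_ne {i n : ℕ} (hi : i < 2) (h : n % 2 ≠ i) :
    ContinuousLinearMap.adjoint (b.cuntz i) (b n) = 0 :=
  b.adjoint_shift_apply_of_forall_ne (two_mul_add_injective i) fun m => by omega

theorem HilbertBasis.star_cuntz_mul_cuntz (i : ℕ) : star (b.cuntz i) * b.cuntz i = 1 :=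
  b.clm_ext fun n => by
    rw [mul_apply_eq_comp, b.cuntz_apply, ContinuousLinearMap.star_eq_adjoint,
      b.adjoint_cuntz_apply, one_apply_eq_self]

theorem HilbertBasis.cuntz_sum :
    b.cuntz 0 * star (b.cuntz 0) + b.cuntz 1 * star (b.cuntz 1) = 1 :=
  b.clm_ext fun n => by
    rw [add_apply, mul_apply_eq_comp, mul_apply_eq_comp, ContinuousLinearMap.star_eq_adjoint,
      ContinuousLinearMap.star_eq_adjoint, one_apply_eq_self]
    obtain ⟨k, rfl | rfl⟩ : ∃ k, n = 2 * k + 0 ∨ n = 2 * k + 1 := ⟨n / 2, by omega⟩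
    · rw [b.adjoint_cuntz_apply, b.adjoint_cuntz_apply_of_mod_ne (i := 1) (by norm_num) (by omega),
        map_zero, add_zero, b.cuntz_apply]
    · rw [b.adjoint_cuntz_apply, b.adjoint_cuntz_apply_of_mod_ne (i := 0) (by norm_num) (by omega),
        map_zero, zero_add, b.cuntz_apply]

/-- The matrix all of whose entries are `1`. Its Cuntz-Krieger algebra is the Cuntz algebra `𝒪₂`. -/
def cuntzMatrix : Matrix (Fin 2) (Fin 2) ℕ := Matrix.of fun _ _ => 1

theorem isNondegenerate_cuntzMatrix : CuntzKrieger.IsNondegenerate cuntzMatrix where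
  two_le := le_rfl
  entries _ _ := Or.inr rfl
  row_ne_zero _ := ⟨0, one_ne_zero⟩
  col_ne_zero _ := ⟨0, one_ne_zero⟩

theorem isCuntzKriegerFamily_of_isometries {t : Fin 2 → H →L[ℂ] H}
    (h : ∀ i, star (t i) * t i = 1) (h' : t 0 * star (t 0) + t 1 * star (t 1) = 1) :
    IsCuntzKriegerFamily cuntzMatrix t where
  partialIsometry i := by rw [mul_assoc, h, mul_one]
  star_mul_self i := by
    rw [h, Fin.sum_univ_two, ← h']
    simp [cuntzMatrix]
  sum_eq_one := by rw [Fin.sum_univ_two, h']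

theorem isCuntzKriegerFamily_cuntz : IsCuntzKriegerFamily cuntzMatrix ![b.cuntz 0, b.cuntz 1] :=
  isCuntzKriegerFamily_of_isometries
    (by intro i; fin_cases i <;> exact b.star_cuntz_mul_cuntz _) b.cuntz_sum

theorem isCuntzKriegerFamily_cuntz_swap :
    IsCuntzKriegerFamily cuntzMatrix ![b.cuntz 1, b.cuntz 0] :=
  isCuntzKriegerFamily_of_isometries
    (by intro i; fin_cases i <;> exact b.star_cuntz_mul_cuntz _)
    ((add_comm _ _).trans b.cuntz_sum)

/-- The isometry `S₁ ⊗ S₁` has no nonzero fixed vector, because the adjoint of `S₁` maps `b a` to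
`b ((a - 1) / 2)` or to zero, and annihilates `b 0`. -/
theorem eq_zero_of_tensorOp_cuntz_one {ω : HilbertTensor H H}
    (hω : tensorOp (b.cuntz 1) (b.cuntz 1) ω = ω) : ω = 0 := by
  have key : ∀ a : ℕ, ∀ y, inner ℂ ω (HilbertTensor.incl (b a ⊗ₜ[ℂ] y)) = 0 := by
    intro a
    induction a using Nat.strong_induction_on with
    | _ a ih =>
      intro y
      have h := inner_tensorMap_tmul (b.cuntz 1) (b.cuntz 1) ω (b a) y
      rw [show tensorMap (b.cuntz 1) (b.cuntz 1) ω = ω from hω] at h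
      rw [h]
      obtain ⟨k, rfl | rfl⟩ : ∃ k, a = 2 * k ∨ a = 2 * k + 1 := ⟨a / 2, by omega⟩
      · rw [b.adjoint_cuntz_apply_of_mod_ne (by norm_num) (by omega), TensorProduct.zero_tmul,
          map_zero, inner_zero_right]
      · rw [b.adjoint_cuntz_apply]
        exact ih k (by omega) _
  obtain ⟨B, hB⟩ := HilbertTensor.exists_clm_inner_tmul ω
  have hB0 : B = 0 := b.clm_ext fun a => by
    ext y
    exact (hB _ _).trans (key a y)
  refine HilbertTensor.eq_zero_of_inner_tmul fun x y => ?_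
  rw [← hB, hB0]
  rfl

/-- In the first tensor product `b 0 ⊗ b 0` is a fixed vector of the generator of index `(0, 1)`,
which acts as `S₀ ⊗ S₀`. In the second one that generator acts as `S₁ ⊗ S₁` and has no fixed vector.
Hence all intertwiners annihilate `b 0 ⊗ b 0`. -/
theorem not_quasiEquiv_cuntz :
    ¬ ((CuntzKrieger.rep H (isCuntzKriegerFamily_cuntz b)).phiTensor
        (CuntzKrieger.rep H (isCuntzKriegerFamily_cuntz_swap b))).QuasiEquiv
      ((CuntzKrieger.rep H (isCuntzKriegerFamily_cuntz_swap b)).phiTensor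
        (CuntzKrieger.rep H (isCuntzKriegerFamily_cuntz b))) := by
  intro hq
  let π₁ := CuntzKrieger.rep H (isCuntzKriegerFamily_cuntz b)
  let π₂ := CuntzKrieger.rep H (isCuntzKriegerFamily_cuntz_swap b)
  have h1 : (π₁.phiTensor π₂).toHom (CuntzKrieger.s _ 1) = tensorOp (b.cuntz 0) (b.cuntz 0) :=
    (CuntzKrieger.phiTensor_s π₁ π₂ 1).trans (congrArg₂ (tensorOp (H := H) (K := H))
      (CuntzKrieger.rep_s H _ _) (CuntzKrieger.rep_s H _ _))
  have h2 : (π₂.phiTensor π₁).toHom (CuntzKrieger.s _ 1) = tensorOp (b.cuntz 1) (b.cuntz 1) :=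
    (CuntzKrieger.phiTensor_s π₂ π₁ 1).trans (congrArg₂ (tensorOp (H := H) (K := H))
      (CuntzKrieger.rep_s H _ _) (CuntzKrieger.rep_s H _ _))
  let v : HilbertTensor H H := HilbertTensor.incl (b 0 ⊗ₜ[ℂ] b 0)
  have hv : tensorOp (b.cuntz 0) (b.cuntz 0) v = v := by
    have h := tensorOp_incl (b.cuntz 0) (b.cuntz 0) (b 0 ⊗ₜ[ℂ] b 0)
    rw [TensorProduct.mapL_tmul, b.cuntz_apply] at h
    exact h
  have hv0 : v = 0 := hq.intertwinersSeparate v fun T hT => by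
    refine eq_zero_of_tensorOp_cuntz_one b ?_
    -- `T v` is fixed by `S₁ ⊗ S₁`, as `v` is fixed by the generator of index `(0, 1)`.
    have h3 := hT (CuntzKrieger.s _ 1) v
    exact (congrArg (fun S : HilbertTensor H H →L[ℂ] HilbertTensor H H => S (T v)) h2.symm).trans
      (h3.symm.trans (congrArg T (Eq.trans
        (congrArg (fun S : HilbertTensor H H →L[ℂ] HilbertTensor H H => S v) h1) hv)))
  have hn : ‖v‖ = 1 := by
    rw [HilbertTensor.norm_incl_tmul, b.orthonormal.1, one_mul]
  rw [hv0, norm_zero] at hn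
  exact zero_ne_one hn

/-- Separable infinite-dimensional Hilbert spaces exist in every universe. -/
theorem exists_hilbertBasis_nat : ∃ (H : Type u) (_ : NormedAddCommGroup H)
    (_ : InnerProductSpace ℂ H) (_ : CompleteSpace H), Nonempty (HilbertBasis ℕ ℂ H) := by
  let b : HilbertBasis (ULift.{u} ℕ) ℂ (lp (fun _ : ULift.{u} ℕ => ℂ) 2) :=
    HilbertBasis.ofRepr (LinearIsometryEquiv.refl ℂ _)
  refine ⟨lp (fun _ : ULift.{u} ℕ => ℂ) 2, inferInstance, inferInstance, inferInstance,
    ⟨HilbertBasis.mk (b.orthonormal.comp ULift.up ULift.up_injective) ?_⟩⟩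
  rw [Set.range_comp, Set.range_eq_univ.mpr ULift.up_surjective, Set.image_univ, b.dense_span]

theorem exists_not_quasiEquiv_swap :
    ∃ π₁ π₂ : HilbertRep.{u} (CuntzKrieger cuntzMatrix),
      ¬ (π₁.phiTensor π₂).QuasiEquiv (π₂.phiTensor π₁) := by
  obtain ⟨H, _, _, _, ⟨b⟩⟩ := exists_hilbertBasis_nat.{u}
  exact ⟨_, _, not_quasiEquiv_cuntz b⟩

end Cuntz

/-! ### Central projections of Cuntz-Krieger algebras -/

section Central

variable {n : ℕ} {A : Matrix (Fin n) (Fin n) ℕ} {C : Type w} [CStarAlgebra C] {t : Fin n → C}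

/-- Range projections which add up to `1` are mutually orthogonal. -/
theorem IsCuntzKriegerFamily.range_mul_range (ht : IsCuntzKriegerFamily A t) {i j : Fin n}
    (hij : i ≠ j) : (t i * star (t i)) * (t j * star (t j)) = 0 := by
  let _ := CStarAlgebra.spectralOrder C
  let _ := CStarAlgebra.spectralOrderedRing C
  let p : Fin n → C := fun k => t k * star (t k)
  have hsa : ∀ k, star (p k) = p k := fun k => by simp [p]
  have hpp : ∀ k, p k * p k = p k := fun k => by
    simp only [p]
    rw [← mul_assoc, ht.partialIsometry]
  have hsum : ∑ k, p j * p k * p j = p j := by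
    rw [← Finset.sum_mul, ← Finset.mul_sum, ht.sum_eq_one, mul_one, hpp]
  have hstar : ∀ k, p j * p k * p j = star (p k * p j) * (p k * p j) := fun k => by
    rw [star_mul, hsa, hsa, mul_assoc (p j) (p k) (p k * p j), ← mul_assoc (p k) (p k), hpp,
      mul_assoc]
  have hrest : ∑ k ∈ Finset.univ.erase j, p j * p k * p j = 0 := by
    rw [← Finset.add_sum_erase _ _ (Finset.mem_univ j), hpp, hpp] at hsum
    exact add_eq_left.mp hsum
  have h0 := (Finset.sum_eq_zero_iff_of_nonneg fun k _ => by
    rw [hstar]; exact star_mul_self_nonneg _).mp hrest i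
    (Finset.mem_erase.mpr ⟨hij, Finset.mem_univ i⟩)
  rw [hstar] at h0
  exact CStarRing.star_mul_self_eq_zero_iff _ |>.mp h0

theorem IsCuntzKriegerFamily.range_mul_of_ne (ht : IsCuntzKriegerFamily A t) {i k : Fin n}
    (hki : k ≠ i) : t k * star (t k) * t i = 0 := by
  rw [← ht.partialIsometry i, ← mul_assoc, ht.range_mul_range hki, zero_mul]

theorem IsCuntzKriegerFamily.mul_range_of_eq_zero (ht : IsCuntzKriegerFamily A t) {i k : Fin n}
    (hik : A i k = 0) : t i * (t k * star (t k)) = 0 := by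
  have h : star (t i) * t i * (t k * star (t k)) = 0 := by
    rw [ht.star_mul_self, Finset.sum_mul]
    refine Finset.sum_eq_zero fun j _ => ?_
    by_cases hj : j = k
    · rw [hj, hik, zero_smul, zero_mul]
    · rw [smul_mul_assoc, ht.range_mul_range hj, smul_zero]
  rw [← ht.partialIsometry i, mul_assoc, mul_assoc, ← mul_assoc (star (t i)), h, mul_zero]

theorem IsCuntzKriegerFamily.sum_range_mul (ht : IsCuntzKriegerFamily A t) {S : Finset (Fin n)}
    {i : Fin n} (hi : i ∈ S) : (∑ k ∈ S, t k * star (t k)) * t i = t i := by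
  rw [Finset.sum_mul, Finset.sum_eq_single_of_mem i hi fun k _ hki => ht.range_mul_of_ne hki,
    ht.partialIsometry]

/-- A union `S` of connected components of the graph of `A` yields a projection which commutes with
the generators. -/
theorem IsCuntzKriegerFamily.commute_sum_range (ht : IsCuntzKriegerFamily A t) (S : Finset (Fin n))
    (hS : ∀ i j, A i j ≠ 0 → (i ∈ S ↔ j ∈ S)) (i : Fin n) :
    Commute (∑ k ∈ S, t k * star (t k)) (t i) := by
  by_cases hi : i ∈ S
  · have h2 : t i * ∑ k ∈ S, t k * star (t k) = t i := by
      conv_rhs => rw [← mul_one (t i), ← ht.sum_eq_one]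
      rw [Finset.mul_sum, Finset.mul_sum]
      refine Finset.sum_subset (Finset.subset_univ S) fun k _ hk => ht.mul_range_of_eq_zero ?_
      by_contra hik
      exact hk ((hS i k hik).mp hi)
    exact (ht.sum_range_mul hi).trans h2.symm
  · have h1 : (∑ k ∈ S, t k * star (t k)) * t i = 0 := by
      rw [Finset.sum_mul]
      exact Finset.sum_eq_zero fun k hk => ht.range_mul_of_ne fun h => hi (h ▸ hk)
    have h2 : t i * ∑ k ∈ S, t k * star (t k) = 0 := by
      rw [Finset.mul_sum]
      refine Finset.sum_eq_zero fun k hk => ht.mul_range_of_eq_zero ?_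
      by_contra hik
      exact hi ((hS i k hik).mpr hk)
    exact h1.trans h2.symm

end Central

/-- Induction for closed properties of elements of `𝒪_A`. -/
theorem CuntzKrieger.induction_on {n : ℕ} {A : Matrix (Fin n) (Fin n) ℕ}
    {p : CuntzKrieger A → Prop} (x : CuntzKrieger A) (hcl : IsClosed {x | p x}) (hone : p 1)
    (hadd : ∀ x y, p x → p y → p (x + y)) (hsmul : ∀ (c : ℂ) x, p x → p (c • x))
    (hmul : ∀ x y, p x → p y → p (x * y)) (hs : ∀ i, p (s A i)) (hstar : ∀ i, p (star (s A i))) :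
    p x := by
  refine (universalSeminorm A).denseRange_toCompletion.induction_on (p := p) x hcl fun a => ?_
  let ι : FreeStarAlgebra (Fin n) →⋆ₐ[ℂ] CuntzKrieger A := (universalSeminorm A).toCompletion
  change p (ι a)
  induction a using FreeStarAlgebra.induction with
  | ha x y hx hy => rw [map_add]; exact hadd _ _ hx hy
  | hm w c =>
    have hc : FreeStarAlgebra.monomial w c = c • FreeStarAlgebra.monomial w 1 := by
      rw [FreeStarAlgebra.smul_monomial, mul_one]
    rw [hc, map_smul]
    refine hsmul _ _ ?_
    clear hc
    induction w using FreeMonoid.inductionOn' with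
    | one => exact (map_one ι).symm ▸ hone
    | of_mul y w ih =>
      have hw := FreeStarAlgebra.monomial_mul (FreeMonoid.of y) w 1 1
      rw [one_mul] at hw
      rw [← hw, map_mul]
      refine hmul _ _ ?_ ih
      rcases y with i | i
      · exact hs i
      · have hsi : FreeStarAlgebra.monomial (FreeMonoid.of (Sum.inr i)) 1 =
            star (FreeStarAlgebra.gen i) := by
          rw [FreeStarAlgebra.gen, FreeStarAlgebra.star_monomial]
          simp [FreeStarAlgebra.wordStar]
        rw [hsi, map_star]
        exact hstar i

/-- The projection of a union `S` of connected components of the graph of `A` is central. -/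
theorem CuntzKrieger.commute_sum_range {n : ℕ} {A : Matrix (Fin n) (Fin n) ℕ} (S : Finset (Fin n))
    (hS : ∀ i j, A i j ≠ 0 → (i ∈ S ↔ j ∈ S)) (x : CuntzKrieger A) :
    Commute (∑ k ∈ S, s A k * star (s A k)) x := by
  have hsa : star (∑ k ∈ S, s A k * star (s A k)) = ∑ k ∈ S, s A k * star (s A k) := by
    simp [star_sum]
  refine induction_on (p := fun x => Commute (∑ k ∈ S, s A k * star (s A k)) x) x
    (isClosed_eq (by fun_prop) (by fun_prop)) (Commute.one_right _) (fun _ _ => Commute.add_right)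
    (fun c _ h => h.smul_right c) (fun _ _ => Commute.mul_right)
    ((isCuntzKriegerFamily_s A).commute_sum_range S hS) fun i => ?_
  have h := ((isCuntzKriegerFamily_s A).commute_sum_range S hS i).star_star
  rwa [hsa] at h

/-! ### The algebra of a permutation of two letters -/

section Flip

/-- The permutation matrix of the transposition. Its Cuntz-Krieger algebra is `M₂(C(𝕋))`. -/
def flipMatrix : Matrix (Fin 2) (Fin 2) ℕ := !![0, 1; 1, 0]

theorem flipMatrix_ne_zero_iff (i j : Fin 2) : flipMatrix i j ≠ 0 ↔ i ≠ j := by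
  fin_cases i <;> fin_cases j <;> simp [flipMatrix]

theorem isNondegenerate_flipMatrix : CuntzKrieger.IsNondegenerate flipMatrix where
  two_le := le_rfl
  entries i j := by fin_cases i <;> fin_cases j <;> simp [flipMatrix]
  row_ne_zero i := ⟨i.rev, (flipMatrix_ne_zero_iff i i.rev).mpr (by revert i; decide)⟩
  col_ne_zero i := ⟨i.rev, (flipMatrix_ne_zero_iff i.rev i).mpr (by revert i; decide)⟩

/-- The indices `(0, 0)` and `(1, 1)` form one of the two components of the graph of `A ⊠ A`. -/
def flipDiagonal : Finset (Fin (2 * 2)) := Finset.univ.filter fun k => k.divNat = k.modNat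

theorem kron_flipMatrix_ne_zero (k l : Fin (2 * 2))
    (h : CuntzKrieger.kron flipMatrix flipMatrix k l ≠ 0) :
    k ∈ flipDiagonal ↔ l ∈ flipDiagonal := by
  rw [CuntzKrieger.kron_apply, mul_ne_zero_iff, flipMatrix_ne_zero_iff, flipMatrix_ne_zero_iff] at h
  have key : ∀ a b c d : Fin 2, a ≠ c ∧ b ≠ d → (a = b ↔ c = d) := by decide
  simpa [flipDiagonal] using key _ _ _ _ h

/-- The matrix units `E₀₁` and `E₁₀`, on a copy of `ℂ²` in an arbitrary universe. -/
noncomputable def flipFamily (i : Fin 2) :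
    EuclideanSpace ℂ (ULift.{u} (Fin 2)) →L[ℂ] EuclideanSpace ℂ (ULift.{u} (Fin 2)) :=
  Matrix.toEuclideanCLM (𝕜 := ℂ) (Matrix.single ⟨i⟩ ⟨i.rev⟩ 1)

theorem star_flipFamily (i : Fin 2) :
    star (flipFamily.{u} i) = Matrix.toEuclideanCLM (𝕜 := ℂ) (Matrix.single ⟨i.rev⟩ ⟨i⟩ 1) := by
  rw [flipFamily, ← map_star, Matrix.star_eq_conjTranspose, Matrix.conjTranspose_single, star_one]

theorem flipFamily_mul_star (i : Fin 2) : flipFamily.{u} i * star (flipFamily i) =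
    Matrix.toEuclideanCLM (𝕜 := ℂ) (Matrix.single ⟨i⟩ ⟨i⟩ 1) := by
  rw [star_flipFamily, flipFamily, ← map_mul, Matrix.single_mul_single_same, one_mul]

theorem isCuntzKriegerFamily_flip : IsCuntzKriegerFamily flipMatrix flipFamily.{u} where
  partialIsometry i := by
    rw [flipFamily_mul_star, flipFamily, ← map_mul, Matrix.single_mul_single_same, one_mul]
  star_mul_self i := by
    simp only [flipFamily_mul_star]
    rw [star_flipFamily, flipFamily, ← map_mul, Matrix.single_mul_single_same, one_mul,
      Fin.sum_univ_two]
    fin_cases i <;> simp [flipMatrix]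
  sum_eq_one := by
    simp only [flipFamily_mul_star]
    rw [← map_sum, ← map_one (Matrix.toEuclideanCLM (𝕜 := ℂ) (n := ULift.{u} (Fin 2)))]
    congr 1
    ext ⟨i⟩ ⟨j⟩
    rw [Fin.sum_univ_two]
    fin_cases i <;> fin_cases j <;> simp [Matrix.single]

/-- The irreducible representation of `𝒪_A` on `ℂ²` by matrix units. -/
noncomputable def flipRep : HilbertRep.{u} (CuntzKrieger flipMatrix) :=
  CuntzKrieger.rep _ isCuntzKriegerFamily_flip.{u}

theorem isFactorRep_flipRep : flipRep.{u}.IsFactorRep := by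
  refine ⟨inferInstanceAs (Nontrivial (EuclideanSpace ℂ (ULift.{u} (Fin 2)))), fun z _ hz => ?_⟩
  have hz' := HilbertRep.mem_commutant_vonNeumann.mp hz
  obtain ⟨Z, hZ⟩ := (Matrix.toEuclideanCLM (𝕜 := ℂ) (n := ULift.{u} (Fin 2))).surjective z
  have hcomm : ∀ i : Fin 2, Commute (Matrix.single (⟨i⟩ : ULift.{u} (Fin 2)) ⟨i.rev⟩ (1 : ℂ)) Z := by
    intro i
    refine (Matrix.toEuclideanCLM (𝕜 := ℂ) (n := ULift.{u} (Fin 2))).injective ?_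
    rw [map_mul, map_mul, hZ]
    have h1 : flipRep.{u}.toHom (CuntzKrieger.s _ i) = flipFamily.{u} i :=
      CuntzKrieger.rep_s _ _ i
    refine ContinuousLinearMap.ext fun ξ => ?_
    have h2 := hz' (CuntzKrieger.s _ i) ξ
    rw [h1] at h2
    exact h2.symm
  obtain ⟨c, hc⟩ := Matrix.mem_range_scalar_of_commute_single (M := Z) (by
    rintro ⟨i⟩ ⟨j⟩ hij
    have : j = i.rev := by
      have h : i ≠ j := fun h => hij (congrArg ULift.up h)
      revert i j; decide
    subst this
    exact hcomm i)
  refine ⟨c, ?_⟩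
  have h1 : Z = c • 1 := by rw [← hc]; simp [Matrix.smul_one_eq_diagonal]
  rw [← hZ, h1]
  exact (map_smul (Matrix.toEuclideanCLM (𝕜 := ℂ) (n := ULift.{u} (Fin 2))) c 1).trans
    (congrArg (c • ·) (map_one _))

/-- The basis vectors of `ℂ²`. -/
noncomputable def flipVec (i : Fin 2) : flipRep.{u}.carrier :=
  (EuclideanSpace.single ⟨i⟩ 1 : EuclideanSpace ℂ (ULift.{u} (Fin 2)))

theorem norm_flipVec (i : Fin 2) : ‖flipVec.{u} i‖ = 1 := by
  have h : ‖(EuclideanSpace.single ⟨i⟩ 1 : EuclideanSpace ℂ (ULift.{u} (Fin 2)))‖ = 1 := by simp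
  exact h

theorem flipRep_range_flipVec (i j : Fin 2) :
    flipRep.{u}.toHom (CuntzKrieger.s _ i * star (CuntzKrieger.s _ i)) (flipVec j) =
      if i = j then flipVec j else 0 := by
  have h1 : flipRep.{u}.toHom (CuntzKrieger.s _ i) = flipFamily.{u} i :=
    CuntzKrieger.rep_s _ _ i
  rw [map_mul, map_star, h1]
  change (flipFamily.{u} i * star (flipFamily.{u} i))
    (EuclideanSpace.single ⟨j⟩ 1 : EuclideanSpace ℂ (ULift.{u} (Fin 2))) =
    if i = j then (EuclideanSpace.single ⟨j⟩ 1 : EuclideanSpace ℂ (ULift.{u} (Fin 2))) else 0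
  rw [flipFamily_mul_star]
  ext ⟨k⟩
  rw [Matrix.ofLp_toEuclideanCLM]
  fin_cases i <;> fin_cases j <;> fin_cases k <;> simp [Matrix.mulVec, Matrix.single]

theorem phiTensor_flipRep_range (k : Fin (2 * 2)) (i j : Fin 2) :
    (flipRep.{u}.phiTensor flipRep.{u}).toHom
        (CuntzKrieger.s _ k * star (CuntzKrieger.s _ k))
        (HilbertRep.tmulVec flipRep.{u} flipRep.{u} (flipVec i) (flipVec j)) =
      if k.divNat = i ∧ k.modNat = j then
        HilbertRep.tmulVec flipRep.{u} flipRep.{u} (flipVec i) (flipVec j) else 0 := by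
  rw [CuntzKrieger.phiTensor_range]
  refine (tensorOp_incl (H := flipRep.carrier) (K := flipRep.carrier) _ _ _).trans ?_
  rw [TensorProduct.mapL_tmul, flipRep_range_flipVec, flipRep_range_flipVec]
  by_cases hi : k.divNat = i <;> by_cases hj : k.modNat = j <;>
    simp [hi, hj, HilbertRep.tmulVec]

/-- The central projection of the component `flipDiagonal` acts as the identity on `e₀ ⊗ e₀` and as
zero on `e₀ ⊗ e₁`. -/
theorem not_isFactorRep_phiTensor_flipRep :
    ¬ (flipRep.{u}.phiTensor flipRep.{u}).IsFactorRep := by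
  rintro ⟨-, h⟩
  let q : CuntzKrieger (CuntzKrieger.kron flipMatrix flipMatrix) :=
    ∑ k ∈ flipDiagonal, CuntzKrieger.s _ k * star (CuntzKrieger.s _ k)
  let π := flipRep.{u}.phiTensor flipRep.{u}
  have hq : ∀ x, Commute q x := CuntzKrieger.commute_sum_range flipDiagonal kron_flipMatrix_ne_zero
  obtain ⟨c, hc⟩ := h (π.toHom q) (π.mem_vonNeumann q)
    (HilbertRep.mem_commutant_vonNeumann.mpr fun x ξ => by
      have h1 := congrArg (fun y => π.toHom y ξ) (hq x).eq
      simp only [map_mul, mul_apply_eq_comp] at h1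
      exact h1)
  let v : Fin 2 → Fin 2 → π.carrier := fun i j =>
    HilbertRep.tmulVec flipRep.{u} flipRep.{u} (flipVec i) (flipVec j)
  have hv : ∀ i j, v i j ≠ 0 := fun i j h0 => by
    have h1 := HilbertRep.norm_tmulVec flipRep.{u} flipRep.{u} (flipVec i) (flipVec j)
    rw [norm_flipVec, norm_flipVec, one_mul] at h1
    rw [show HilbertRep.tmulVec flipRep.{u} flipRep.{u} (flipVec i) (flipVec j) = 0 from h0,
      norm_zero] at h1
    exact zero_ne_one h1
  have hqv : ∀ i j, c • v i j = if i = j then v i j else 0 := fun i j => by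
    have h1 : π.toHom q (v i j) = c • v i j := congrArg (fun T => T (v i j)) hc
    have h2 : ∀ k, π.toHom (CuntzKrieger.s _ k * star (CuntzKrieger.s _ k)) (v i j) =
        if k.divNat = i ∧ k.modNat = j then v i j else 0 := fun k => phiTensor_flipRep_range k i j
    rw [← h1, map_sum, sum_apply, Finset.sum_congr rfl fun k _ => h2 k, flipDiagonal,
      Finset.sum_filter]
    rw [CuntzKrieger.sum_divNat_modNat (n := 2) (m := 2) fun a b => if a = b then
      (if a = i ∧ b = j then v i j else 0) else 0]
    fin_cases i <;> fin_cases j <;> simp [Fin.sum_univ_two]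
  have h0 := hqv 0 0
  have h1 := hqv 0 1
  rw [if_neg (by decide)] at h1
  rw [(smul_eq_zero.mp h1).resolve_right (hv 0 1), zero_smul, if_pos rfl] at h0
  exact hv 0 0 h0.symm

end Flip

/-! ### Products of states -/

namespace CStarState

theorem denseRange_gns {𝒜 : Type v} [CStarAlgebra 𝒜] (ρ : CStarState 𝒜) :
    DenseRange fun x => ρ.gns.toHom x ρ.gnsVector := by
  let _ := CStarAlgebra.spectralOrder 𝒜
  let _ := CStarAlgebra.spectralOrderedRing 𝒜
  have h : ∀ x, ρ.toPositive.gnsStarAlgHom x ρ.cyclicVector =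
      ((ρ.toPositive.toPreGNS x : ρ.toPositive.PreGNS) : ρ.toPositive.GNS) := fun x => by
    change ρ.toPositive.gnsNonUnitalStarAlgHom x _ = _
    rw [cyclicVector, PositiveLinearMap.gnsNonUnitalStarAlgHom_apply_coe,
      PositiveLinearMap.leftMulMapPreGNS_apply]
    simp
  have h2 : DenseRange fun x => ρ.toPositive.gnsStarAlgHom x ρ.cyclicVector := by
    rw [funext h]
    exact UniformSpace.Completion.denseRange_coe.comp ρ.toPositive.toPreGNS.surjective.denseRange
      (UniformSpace.Completion.continuous_coe _)
  exact h2

theorem gns_apply_eq_zero {𝒜 : Type v} [CStarAlgebra 𝒜] (ρ : CStarState 𝒜) {x : 𝒜}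
    (hx : ρ (star x * x) = 0) : ρ.gns.toHom x ρ.gnsVector = 0 := by
  rw [← inner_gnsVector, map_mul, map_star, mul_apply_eq_comp,
    ContinuousLinearMap.star_eq_adjoint, ContinuousLinearMap.adjoint_inner_right] at hx
  exact inner_self_eq_zero.mp hx

/-- A central element which annihilates the cyclic vector is zero in the GNS representation. -/
theorem gns_toHom_eq_zero {𝒜 : Type v} [CStarAlgebra 𝒜] (ρ : CStarState 𝒜) {q : 𝒜}
    (hq : ∀ x, Commute q x) (h : ρ.gns.toHom q ρ.gnsVector = 0) : ρ.gns.toHom q = 0 := by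
  refine DFunLike.coe_injective (ρ.denseRange_gns.equalizer (ρ.gns.toHom q).continuous
    (0 : ρ.gns.carrier →L[ℂ] ρ.gns.carrier).continuous (funext fun x => ?_))
  simp only [Function.comp_apply, zero_apply]
  rw [← mul_apply_eq_comp, ← map_mul, (hq x).eq, map_mul, mul_apply_eq_comp, h, map_zero]

theorem phiTensor_range {n m : ℕ} {A : Matrix (Fin n) (Fin n) ℕ} {B : Matrix (Fin m) (Fin m) ℕ}
    (ρ₁ : CStarState (CuntzKrieger A)) (ρ₂ : CStarState (CuntzKrieger B)) (k : Fin (n * m)) :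
    ρ₁.phiTensor ρ₂ (CuntzKrieger.s _ k * star (CuntzKrieger.s _ k)) =
      ρ₁ (CuntzKrieger.s A k.divNat * star (CuntzKrieger.s A k.divNat)) *
        ρ₂ (CuntzKrieger.s B k.modNat * star (CuntzKrieger.s B k.modNat)) := by
  rw [← minTensor_tmul]
  refine congrArg (ρ₁.minTensor ρ₂) ?_
  change CuntzKrieger.phi A B _ = _
  rw [map_mul, map_star, CuntzKrieger.phi_s]
  simp only [MinTensor.tmul]
  rw [← map_star, ← map_mul, TensorProduct.star_tmul, Algebra.TensorProduct.tmul_mul_tmul]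

end CStarState

section Flip

theorem flip_range_add_source (i : Fin 2) :
    CuntzKrieger.s flipMatrix i * star (CuntzKrieger.s flipMatrix i) +
      star (CuntzKrieger.s flipMatrix i) * CuntzKrieger.s flipMatrix i = 1 := by
  have h := CuntzKrieger.isCuntzKriegerFamily_s flipMatrix
  rw [h.star_mul_self, ← h.sum_eq_one, Fin.sum_univ_two, Fin.sum_univ_two]
  fin_cases i
  · change _ + (0 • _ + 1 • _) = _
    rw [zero_smul, one_smul, zero_add]
    rfl
  · change _ + (1 • _ + 0 • _) = _
    rw [zero_smul, one_smul, add_zero, add_comm]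
    rfl

theorem exists_flip_s_apply_ne_zero (π : HilbertRep.{u} (CuntzKrieger flipMatrix))
    [Nontrivial π.carrier] (i : Fin 2) : ∃ ξ, π.toHom (CuntzKrieger.s _ i) ξ ≠ 0 := by
  by_contra! h
  have h0 : π.toHom (CuntzKrieger.s _ i) = 0 := ContinuousLinearMap.ext h
  have h1 := congrArg π.toHom (flip_range_add_source i)
  rw [map_add, map_mul, map_mul, h0, zero_mul, mul_zero, add_zero, map_one] at h1
  exact zero_ne_one h1

/-- The vector state of `e₀` in the representation on `ℂ²`. -/
noncomputable def flipState : CStarState (CuntzKrieger flipMatrix) :=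
  CStarState.ofVector flipRep.{0} (flipVec 0) (norm_flipVec 0)

theorem flipState_range (i : Fin 2) :
    flipState (CuntzKrieger.s _ i * star (CuntzKrieger.s _ i)) = if i = 0 then 1 else 0 := by
  rw [flipState, CStarState.ofVector_apply, flipRep_range_flipVec]
  split_ifs
  · rw [inner_self_eq_norm_sq_to_K, norm_flipVec]; simp
  · rw [inner_zero_right]

/-- The product state lives on the component of the indices `(0, 0)` and `(1, 1)`, so that the
central projection of the other component vanishes in its GNS representation. -/
theorem gns_phiTensor_flipState_s :
    (flipState.phiTensor flipState).gns.toHom (CuntzKrieger.s _ 1) = 0 := by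
  set ρ := flipState.phiTensor flipState with hρ
  have hS : ∀ k l, CuntzKrieger.kron flipMatrix flipMatrix k l ≠ 0 →
      (k ∈ flipDiagonalᶜ ↔ l ∈ flipDiagonalᶜ) := fun k l h => by
    rw [Finset.mem_compl, Finset.mem_compl, kron_flipMatrix_ne_zero k l h]
  have hfam := CuntzKrieger.isCuntzKriegerFamily_s (CuntzKrieger.kron flipMatrix flipMatrix)
  have hzero : ∀ k ∈ flipDiagonalᶜ, ρ.gns.toHom (star (CuntzKrieger.s _ k)) ρ.gnsVector = 0 := by
    intro k hk
    refine ρ.gns_apply_eq_zero ?_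
    rw [star_star, hρ, CStarState.phiTensor_range, flipState_range, flipState_range]
    have hne : k.divNat ≠ k.modNat := by simpa [flipDiagonal] using hk
    by_cases h0 : k.modNat = 0
    · rw [if_neg (fun h => hne (h.trans h0.symm)), zero_mul]
    · rw [if_neg h0, mul_zero]
  have hq := ρ.gns_toHom_eq_zero (CuntzKrieger.commute_sum_range flipDiagonalᶜ hS) (by
    rw [map_sum, sum_apply]
    refine Finset.sum_eq_zero fun k hk => ?_
    rw [map_mul, mul_apply_eq_comp, hzero k hk, map_zero])
  rw [← hfam.sum_range_mul (S := flipDiagonalᶜ) (i := 1) (by decide), map_mul, hq, zero_mul]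

theorem not_quasiEquiv_gns_flipState :
    ¬ (flipState.gns.phiTensor flipState.gns).QuasiEquiv (flipState.phiTensor flipState).gns := by
  rintro ⟨f, hf⟩
  have h0 : (flipState.gns.phiTensor flipState.gns).toHom (CuntzKrieger.s _ 1) = 0 := by
    have h1 := (hf (CuntzKrieger.s _ 1)).trans gns_phiTensor_flipState_s
    have h2 := (EmbeddingLike.map_eq_zero_iff (f := f)).mp (Subtype.ext h1)
    exact congrArg Subtype.val h2
  have : Nontrivial flipState.gns.carrier := ⟨flipState.gnsVector, 0, fun h => by
    have h1 := flipState.norm_gnsVector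
    rw [h, norm_zero] at h1
    exact zero_ne_one h1⟩
  obtain ⟨ξ, hξ⟩ := exists_flip_s_apply_ne_zero flipState.gns 0
  obtain ⟨η, hη⟩ := exists_flip_s_apply_ne_zero flipState.gns 1
  rw [CuntzKrieger.phiTensor_s] at h0
  have h1 := tensorOp_incl (flipState.gns.toHom (CuntzKrieger.s _ 0))
    (flipState.gns.toHom (CuntzKrieger.s _ 1)) (ξ ⊗ₜ[ℂ] η)
  have h2 := congrArg (fun T => ‖T (HilbertTensor.incl (ξ ⊗ₜ[ℂ] η))‖) h0
  have h3 : ‖tensorOp (flipState.gns.toHom (CuntzKrieger.s _ 0))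
    (flipState.gns.toHom (CuntzKrieger.s _ 1)) (HilbertTensor.incl (ξ ⊗ₜ[ℂ] η))‖ = 0 :=
    h2.trans norm_zero
  rw [h1, TensorProduct.mapL_tmul, HilbertTensor.norm_incl_tmul, mul_eq_zero, norm_eq_zero,
    norm_eq_zero] at h3
  exact h3.elim hξ hη

end Flip

theorem mainTheorem7 :
    -- (i) the product of two factor representations need not be a factor representation
    (∃ (n : ℕ) (A : Matrix (Fin n) (Fin n) ℕ), CuntzKrieger.IsNondegenerate A ∧
      ∃ π₁ π₂ : HilbertRep.{u} (CuntzKrieger A),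
        π₁.IsFactorRep ∧ π₂.IsFactorRep ∧ ¬ (π₁.phiTensor π₂).IsFactorRep) ∧
    -- (ii) the product is non-symmetric up to quasi-equivalence
    (∃ (n : ℕ) (A : Matrix (Fin n) (Fin n) ℕ), CuntzKrieger.IsNondegenerate A ∧
      ∃ π₁ π₂ : HilbertRep.{u} (CuntzKrieger A),
        ¬ (π₁.phiTensor π₂).QuasiEquiv (π₂.phiTensor π₁)) ∧
    -- (iii) the product respects quasi-equivalence
    (∀ (n m : ℕ) (A : Matrix (Fin n) (Fin n) ℕ) (B : Matrix (Fin m) (Fin m) ℕ),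
      CuntzKrieger.IsNondegenerate A → CuntzKrieger.IsNondegenerate B →
      ∀ (π₁ π₁' : HilbertRep.{u} (CuntzKrieger A)) (π₂ π₂' : HilbertRep.{u} (CuntzKrieger B)),
        π₁.QuasiEquiv π₁' → π₂.QuasiEquiv π₂' →
          (π₁.phiTensor π₂).QuasiEquiv (π₁'.phiTensor π₂')) ∧
    -- (iv) the product does not commute with the GNS construction up to quasi-equivalence
    (∃ (n m : ℕ) (A : Matrix (Fin n) (Fin n) ℕ) (B : Matrix (Fin m) (Fin m) ℕ),
      CuntzKrieger.IsNondegenerate A ∧ CuntzKrieger.IsNondegenerate B ∧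
      ∃ (ρ₁ : CStarState (CuntzKrieger A)) (ρ₂ : CStarState (CuntzKrieger B)),
        ¬ (ρ₁.gns.phiTensor ρ₂.gns).QuasiEquiv (ρ₁.phiTensor ρ₂).gns) := by
  refine ⟨⟨2, flipMatrix, isNondegenerate_flipMatrix, flipRep, flipRep, isFactorRep_flipRep,
    isFactorRep_flipRep, not_isFactorRep_phiTensor_flipRep⟩,
    ⟨2, cuntzMatrix, isNondegenerate_cuntzMatrix, exists_not_quasiEquiv_swap⟩,
    fun n m A B _ _ π₁ π₁' π₂ π₂' h₁ h₂ => h₁.minTensor_comp h₂ (CuntzKrieger.phi A B),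
    ⟨2, 2, flipMatrix, flipMatrix, isNondegenerate_flipMatrix, isNondegenerate_flipMatrix,
      flipState, flipState, not_quasiEquiv_gns_flipState⟩⟩
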